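/- Work over $\mathbb C$. Let $1\le d\le n-d$, let $V$ be a vector space with basis $v_1,\dots,v_n$, and put $V_d=\mathrm{span}(v_1,\dots,v_d)$, $V_{n-d}=\mathrm{span}(v_{d+1},\dots,v_n)$. For a $d$-subset $I=\{i_1<\dots<i_d\}$ of $\{1,\dots,n\}$ let $v_I=v_{i_1}\wedge\dots\wedge v_{i_d}$ and $\deg I=\#\{i\in I: i>d\}$; for $0\le s\le d$ let $(\Lambda^dV)_s=\Lambda^dV/\mathrm{span}(v_I:\deg I>s)$, and let $w_s$ be the class of $v_1\wedge\dots\wedge v_d$. Let $\mathfrak a_d\subset\mathrm{End}(V)$ be the abelian Lie algebra spanned by the matrix units $E_{i,j}$ with $i>d\ge j$. For $1\le s\le d$ the truncated Grassmannian is the Zariski closure $$X_s=\overline{\exp(\mathfrak a_d).[w_s]}\subset\mathbb P((\Lambda^dV)_s).$$ Let $\mathrm{Gr}_d(V)\subset\mathbb P(\Lambda^dV)$ be the Grassmannian of $d$-dimensional subspaces in its Plücker embedding and $S_s=\{U\in\mathrm{Gr}_d(V):\dim(U\cap V_{n-d})\ge s\}$. Let $R_{s;d,n-d}$ be the subalgebra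 generated by all $s$-minors of the matrix $(z_{i,j})_{d<i\le n,\,1\le j\le d}$ inside the polynomial ring $\mathbb C[z_{i,j}]$, graded so that the $s$-minors have degree one. Regard $\mathrm{Hom}(\Lambda^sV_d,\Lambda^sV_{n-d})\simeq\Lambda^{d-s}V_d\otimes\Lambda^sV_{n-d}$ as the subspace of $(\Lambda^dV)_s$ spanned by the classes of the $v_I$ with $\deg I=s$ (the homomorphism sending $v_J$ to $v_L$ and all other $v_{J'}$ to $0$ corresponds to $v_1\wedge\dots\wedge v_d$ with the factors from $J$ replaced, in increasing order, by those from $L$). **Proposition.** Let $2\le r\le d+1$. 1. The set $\mathrm{Gr}_d(V)\setminus S_{r-1}$ is open in $\mathrm{Gr}_d(V)$, the projection $\mathbb P(\Lambda^dV)\dashrightarrow\mathbb P((\Lambda^dV)_{r-1})$ is defined on it, and the restriction of the projection to it is an isomorphism of varieties onto an open subset of $X_{r-1}$. 2. The minors define a closed immersion of the scheme $\mathrm{Proj}(R_{r-1;d,n-d})$ into $\mathbb P\,\mathrm{Hom}(\Lambda^{r-1}V_d,\Lambda^{r-1}V_{n-d})$, whose image, as a variety, is the Zariski closure of the set of points $[\Lambda^{r-1}\varphi]$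 with $\varphi\in\mathrm{Hom}(V_d,V_{n-d})$, $\Lambda^{r-1}\varphi\ne0$. 3. $X_{r-1}$ is the disjoint union of the image of $\mathrm{Gr}_d(V)\setminus S_{r-1}$ and of $\mathrm{Proj}(R_{r-1;d,n-d})\subset\mathbb P\,\mathrm{Hom}(\Lambda^{r-1}V_d,\Lambda^{r-1}V_{n-d})\subset\mathbb P((\Lambda^dV)_{r-1})$. -/

import Mathlib

open scoped LinearAlgebra.Projectivization Topology
open Module AlgebraicGeometry

noncomputable section

namespace TruncGr

/-! ### Classical projective varieties over the complex numbers -/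

section Varieties

variable {W W' : Type*} [AddCommGroup W] [Module ℂ W] [AddCommGroup W'] [Module ℂ W']

/-- The value at `w` of the polynomial function on `W` given by a polynomial in linear forms. -/
def polyVal (F : MvPolynomial (Module.Dual ℂ W) ℂ) (w : W) : ℂ :=
  MvPolynomial.eval (fun l : Module.Dual ℂ W => l w) F

/-- The Zariski topology on the projective space `ℙ(W)`: the non-vanishing loci of homogeneous
polynomial functions form a basis of open sets. -/
@[reducible] def zariski (W : Type*) [AddCommGroup W] [Module ℂ W] : TopologicalSpace (ℙ ℂ W) :=
  TopologicalSpace.generateFrom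
    {O | ∃ (k : ℕ) (F : MvPolynomial (Module.Dual ℂ W) ℂ), F.IsHomogeneous k ∧
      O = {p : ℙ ℂ W | polyVal F p.rep ≠ 0}}

/-- `A` is the intersection of `B` with a Zariski open set. -/
def IsOpenIn (A B : Set (ℙ ℂ W)) : Prop :=
  ∃ O : Set (ℙ ℂ W), IsOpen[zariski W] O ∧ A = B ∩ O

/-- `F : W → W'` is a homogeneous polynomial map of degree `k`. -/
def IsHomogPolyMap (k : ℕ) (F : W → W') : Prop :=
  ∀ l : Module.Dual ℂ W', ∃ P : MvPolynomial (Module.Dual ℂ W) ℂ,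
    P.IsHomogeneous k ∧ ∀ w, l (F w) = polyVal P w

/-- A map from a (locally closed) subset of a projective space to a projective space is regular
if near every point it is given by homogeneous polynomials of one and the same degree without
common zero. -/
def IsRegularMap {A : Set (ℙ ℂ W)} (f : A → ℙ ℂ W') : Prop :=
  ∀ x : A, ∃ (k : ℕ) (F : W → W'), IsHomogPolyMap k F ∧ F x.1.rep ≠ 0 ∧
    ∀ (y : A) (hy : F y.1.rep ≠ 0), f y = Projectivization.mk ℂ (F y.1.rep) hy

/-- A regular map that is an isomorphism onto its image: it has a regular inverse there. -/
def IsRegularEmbedding {A : Set (ℙ ℂ W)} (f : A → ℙ ℂ W') : Prop :=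
  IsRegularMap f ∧ ∃ g : Set.range f → ℙ ℂ W, IsRegularMap g ∧
    ∀ x : A, g ⟨f x, Set.mem_range_self x⟩ = x.1

/-- The domain of definition of the linear projection `ℙ(W) ⇢ ℙ(W')` induced by `q`. -/
def projDomain (q : W →ₗ[ℂ] W') : Set (ℙ ℂ W) := {p | q p.rep ≠ 0}

/-- The linear projection `ℙ(W) ⇢ ℙ(W')`, `[w] ↦ [q w]`, on its domain of definition. -/
def linProj (q : W →ₗ[ℂ] W') (p : projDomain q) : ℙ ℂ W' :=
  Projectivization.mk ℂ (q p.1.rep) p.2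

end Varieties

/-! ### The Grassmannian and its truncations

`V` has a basis `b` indexed by `Fin (d + m)`, i.e. `n = d + m`. -/

variable {V : Type*} [AddCommGroup V] [Module ℂ V] {d m : ℕ}

/-- `V_d`, the span of the first `d` basis vectors. -/
def lowSpace (b : Basis (Fin (d + m)) ℂ V) : Submodule ℂ V :=
  Submodule.span ℂ (Set.range (b ∘ Fin.castAdd m))

/-- `V_{n-d}`, the span of the last `m = n - d` basis vectors. -/
def highSpace (b : Basis (Fin (d + m)) ℂ V) : Submodule ℂ V :=
  Submodule.span ℂ (Set.range (b ∘ Fin.natAdd d))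

/-- The basis of `V_d` consisting of the first `d` basis vectors. -/
def lowBasis (b : Basis (Fin (d + m)) ℂ V) : Basis (Fin d) ℂ (lowSpace b) :=
  Basis.span (b.linearIndependent.comp _ (Fin.castAdd_injective d m))

/-- The basis of `V_{n-d}` consisting of the last `m` basis vectors. -/
def highBasis (b : Basis (Fin (d + m)) ℂ V) : Basis (Fin m) ℂ (highSpace b) :=
  Basis.span (b.linearIndependent.comp _ (Fin.natAdd_injective m d))

/-- The Grassmannian of `d`-dimensional subspaces. -/
abbrev Gr (V : Type*) [AddCommGroup V] [Module ℂ V] (d : ℕ) : Type _ :=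
  {U : Submodule ℂ V // Module.finrank ℂ U = d}

/-- For `U` of dimension `d`, the image of `⋀^d U` in `⋀^d V` is a line. -/
theorem finrank_range_wedge (b : Basis (Fin (d + m)) ℂ V) (U : Gr V d) :
    Module.finrank ℂ (LinearMap.range (exteriorPower.map d U.1.subtype)) = 1 := by
  have hV : Module.Finite ℂ V := Module.Finite.of_basis b
  rw [LinearMap.finrank_range_of_inj
    (exteriorPower.map_injective_field (by simp)), exteriorPower.finrank_eq, U.2, Nat.choose_self]

/-- The Plücker embedding: `U` is sent to the line `⋀^d U` in `⋀^d V`. -/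
def plucker (b : Basis (Fin (d + m)) ℂ V) (U : Gr V d) : ℙ ℂ (⋀[ℂ]^d V) :=
  Projectivization.mk'' _ (finrank_range_wedge b U)

/-- The Schubert variety `S_s`: subspaces `U` with `dim (U ∩ V_{n-d}) ≥ s`. -/
def schubert (b : Basis (Fin (d + m)) ℂ V) (s : ℕ) : Set (Gr V d) :=
  {U | s ≤ Module.finrank ℂ (U.1 ⊓ highSpace b : Submodule ℂ V)}

/-- The degree of a `d`-subset `I` of `{1, …, n}`: the number of its elements beyond the
first `d`. -/
def deg (I : Set.powersetCard (Fin (d + m)) d) : ℕ :=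
  (I.1.filter fun i : Fin (d + m) => d ≤ i.val).card

/-- The span of the wedge monomials `v_I` of degree larger than `s`. -/
def highDeg (b : Basis (Fin (d + m)) ℂ V) (s : ℕ) : Submodule ℂ (⋀[ℂ]^d V) :=
  Submodule.span ℂ {w | ∃ I : Set.powersetCard (Fin (d + m)) d,
    s < deg I ∧ w = b.exteriorPower d I}

/-- The truncated wedge power `(Λ^d V)_s`. -/
abbrev TruncWedge (b : Basis (Fin (d + m)) ℂ V) (s : ℕ) : Type _ :=
  (⋀[ℂ]^d V) ⧸ highDeg b s

/-- The quotient map `Λ^d V → (Λ^d V)_s`. -/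
def truncMap (b : Basis (Fin (d + m)) ℂ V) (s : ℕ) : (⋀[ℂ]^d V) →ₗ[ℂ] TruncWedge b s :=
  (highDeg b s).mkQ

/-- The abelian Lie algebra `𝔞_d`, spanned by the matrix units `E_{i,j}` with `i > d ≥ j`. -/
def abelianRadical (b : Basis (Fin (d + m)) ℂ V) : Submodule ℂ (Module.End ℂ V) :=
  Submodule.span ℂ (Set.range fun ij : Fin m × Fin d =>
    (b.coord (Fin.castAdd m ij.2)).smulRight (b (Fin.natAdd d ij.1)))

/-- Any two elements of `𝔞_d` compose to zero; hence `exp a = 1 + a` for `a ∈ 𝔞_d`. -/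
theorem abelianRadical_mul (b : Basis (Fin (d + m)) ℂ V) {a a' : Module.End ℂ V}
    (ha : a ∈ abelianRadical b) (ha' : a' ∈ abelianRadical b) : a * a' = 0 := by
  induction ha using Submodule.span_induction with
  | mem x hx =>
    obtain ⟨⟨i, j⟩, rfl⟩ := hx
    induction ha' using Submodule.span_induction with
    | mem y hy =>
      obtain ⟨⟨i', j'⟩, rfl⟩ := hy
      ext v
      have : Fin.natAdd d i' ≠ Fin.castAdd m j := by
        intro h
        have := congrArg Fin.val h
        simp at this
        omega
      simp [Finsupp.single_eq_of_ne this.symm]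
    | zero => simp
    | add y z _ _ hy hz => rw [mul_add, hy, hz, add_zero]
    | smul c y _ hy => rw [mul_smul_comm, hy, smul_zero]
  | zero => simp
  | add y z _ _ hy hz => rw [add_mul, hy, hz, add_zero]
  | smul c y _ hy => rw [smul_mul_assoc, hy, smul_zero]

/-- The group `exp(𝔞_d)`; since `a * a = 0` for `a ∈ 𝔞_d`, one has `exp a = 1 + a`. -/
def expRadical (b : Basis (Fin (d + m)) ℂ V) : Set (Module.End ℂ V) :=
  {g | ∃ a ∈ abelianRadical b, g = 1 + a}

/-- The highest weight vector `v_1 ∧ ⋯ ∧ v_d`. -/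
def topVector (b : Basis (Fin (d + m)) ℂ V) : ⋀[ℂ]^d V :=
  exteriorPower.ιMulti ℂ d (b ∘ Fin.castAdd m)

/-- The orbit `exp(𝔞_d).[w_s]` in `ℙ((Λ^d V)_s)`, where `w_s` is the class of `v_1 ∧ ⋯ ∧ v_d`.
The group acts on the quotient `(Λ^d V)_s` through its action on `Λ^d V`. -/
def truncOrbit (b : Basis (Fin (d + m)) ℂ V) (s : ℕ) : Set (ℙ ℂ (TruncWedge b s)) :=
  {p | ∃ g ∈ expRadical b,
    ∃ h : truncMap b s (exteriorPower.map d g (topVector b)) ≠ 0, p = Projectivization.mk ℂ _ h}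

/-- The truncated Grassmannian `X_s`, the Zariski closure of the orbit. -/
def truncGr (b : Basis (Fin (d + m)) ℂ V) (s : ℕ) : Set (ℙ ℂ (TruncWedge b s)) :=
  closure[zariski (TruncWedge b s)] (truncOrbit b s)

/-! ### The projective space of homomorphisms `Λ^s V_d → Λ^s V_{n-d}` -/

/-- `Hom(Λ^s V_d, Λ^s V_{n-d})`. -/
abbrev WedgeHom (b : Basis (Fin (d + m)) ℂ V) (s : ℕ) : Type _ :=
  (⋀[ℂ]^s (lowSpace b)) →ₗ[ℂ] (⋀[ℂ]^s (highSpace b))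

/-- Pairs `(J, L)` of an `s`-subset of columns `{1, …, d}` and an `s`-subset of rows
`{1, …, m}`. -/
abbrev MinorIndex (d m s : ℕ) : Type :=
  Set.powersetCard (Fin d) s × Set.powersetCard (Fin m) s

/-- The matrix coefficient of a homomorphism `Λ^s V_d → Λ^s V_{n-d}` at the basis vectors `v_J`
and `v_L`. -/
def homCoord (b : Basis (Fin (d + m)) ℂ V) (s : ℕ) (x : MinorIndex d m s) :
    WedgeHom b s →ₗ[ℂ] ℂ :=
  (((highBasis b).exteriorPower s).coord x.2).comp
    (LinearMap.applyₗ ((lowBasis b).exteriorPower s x.1))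

/-- The indices of the vectors that arise from `v_1, …, v_d` when, for `J = {j_1 < ⋯ < j_s}` and
`L = {l_1 < ⋯ < l_s}`, each `v_{j_t}` is replaced by `v_{d + l_t}`. -/
def swapIndex {s : ℕ} (x : MinorIndex d m s) (k : Fin d) : Fin (d + m) :=
  if h : k ∈ x.1.1 then
    Fin.natAdd d (Set.powersetCard.ofFinEmbEquiv.symm x.2
      ((x.1.1.orderIsoOfFin (Set.powersetCard.card_eq x.1)).symm ⟨k, h⟩))
  else Fin.castAdd m k

/-- The inclusion `Hom(Λ^s V_d, Λ^s V_{n-d}) ⊂ (Λ^d V)_s` coming from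
`Λ^{d-s} V_d ⊗ Λ^s V_{n-d}` and `Λ^{d-s} V_d ≃ (Λ^s V_d)^*`: the elementary homomorphism `v_J ↦ v_L`
goes to `v_1 ∧ ⋯ ∧ v_d` with the factors from `J` replaced by those from `L`, which is
`± v_{[d] ∖ J} ∧ v_L`. -/
def homIncl (b : Basis (Fin (d + m)) ℂ V) (s : ℕ) : WedgeHom b s →ₗ[ℂ] TruncWedge b s :=
  ∑ x : MinorIndex d m s, (homCoord b s x).smulRight
    (truncMap b s (exteriorPower.ιMulti ℂ d (b ∘ swapIndex x)))

/-- The range of `swapIndex (J, L)` meets the first `d` indices in the complement of `J`. -/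
theorem castAdd_mem_range_swapIndex {s : ℕ} (x : MinorIndex d m s) (k : Fin d) :
    Fin.castAdd m k ∈ Set.range (swapIndex x) ↔ k ∉ x.1.1 := by
  constructor
  · rintro ⟨k', hk'⟩ hk
    unfold swapIndex at hk'
    split_ifs at hk' with h
    · have := congrArg Fin.val hk'
      simp at this
      omega
    · exact h (Fin.castAdd_injective d m hk' ▸ hk)
  · intro hk
    exact ⟨k, by simp [swapIndex, hk]⟩

/-- The range of `swapIndex (J, L)` meets the last `m` indices in `L`. -/
theorem natAdd_mem_range_swapIndex {s : ℕ} (x : MinorIndex d m s) (l : Fin m) :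
    Fin.natAdd d l ∈ Set.range (swapIndex x) ↔ l ∈ x.2.1 := by
  constructor
  · rintro ⟨k, hk⟩
    unfold swapIndex at hk
    split_ifs at hk with h
    · rw [← Fin.natAdd_injective m d hk]
      exact Finset.orderEmbOfFin_mem x.2.1 x.2.2 _
    · have := congrArg Fin.val hk
      simp at this
      omega
  · intro hl
    have h1 : l ∈ Set.range (Set.powersetCard.ofFinEmbEquiv.symm x.2) :=
      (Set.powersetCard.mem_range_ofFinEmbEquiv_symm_iff_mem x.2 l).2 hl
    obtain ⟨t, rfl⟩ := h1
    refine ⟨(x.1.1.orderIsoOfFin (Set.powersetCard.card_eq x.1) t).1, ?_⟩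
    simp [swapIndex]
    exact OrderIso.symm_apply_apply (x.1.1.orderIsoOfFin (Set.powersetCard.card_eq x.1)) t

theorem swapIndex_injective {s : ℕ} (x : MinorIndex d m s) : Function.Injective (swapIndex x) := by
  intro k k' h
  unfold swapIndex at h
  split_ifs at h with h1 h2 h2
  · have := (x.1.1.orderIsoOfFin (Set.powersetCard.card_eq x.1)).symm.injective
      ((Set.powersetCard.ofFinEmbEquiv.symm x.2).injective (Fin.natAdd_injective m d h))
    simpa using this
  · have := congrArg Fin.val h
    simp at this
    omega
  · have := congrArg Fin.val h
    simp at this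
    omega
  · exact Fin.castAdd_injective d m h

/-- Coordinate forms vanish on wedge products having a basis vector outside the index range. -/
theorem pairing_eq_zero (b : Basis (Fin (d + m)) ℂ V) (f g : Fin d → Fin (d + m)) (i : Fin d)
    (hi : g i ∉ Set.range f) :
    exteriorPower.pairingDual ℂ V d (exteriorPower.ιMulti ℂ d (b.coord ∘ f))
      (exteriorPower.ιMulti ℂ d (b ∘ g)) = 0 := by
  rw [exteriorPower.pairingDual_ιMulti_ιMulti]
  apply Matrix.det_eq_zero_of_row_eq_zero i
  intro j
  have h : f j ≠ g i := fun h => hi ⟨j, h⟩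
  simp [Finsupp.single_eq_of_ne h]

theorem pairing_self (b : Basis (Fin (d + m)) ℂ V) (f : Fin d → Fin (d + m))
    (hf : Function.Injective f) :
    exteriorPower.pairingDual ℂ V d (exteriorPower.ιMulti ℂ d (b.coord ∘ f))
      (exteriorPower.ιMulti ℂ d (b ∘ f)) = 1 := by
  rw [exteriorPower.pairingDual_ιMulti_ιMulti]
  convert! Matrix.det_one (n := Fin d) (R := ℂ)
  ext i j
  simp [Matrix.one_apply, Finsupp.single_apply, hf.eq_iff]

theorem pairing_highDeg (b : Basis (Fin (d + m)) ℂ V) {s : ℕ} (x : MinorIndex d m s)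
    {w : ⋀[ℂ]^d V} (hw : w ∈ highDeg b s) :
    exteriorPower.pairingDual ℂ V d (exteriorPower.ιMulti ℂ d (b.coord ∘ swapIndex x)) w = 0 := by
  induction hw using Submodule.span_induction with
  | mem w hw =>
    obtain ⟨I, hI, rfl⟩ := hw
    have h1 : ∃ i ∈ I.1, d ≤ i.val ∧ i ∉ Set.range (swapIndex x) := by
      by_contra! hcon
      have h2 : (I.1.filter fun i : Fin (d + m) => d ≤ i.val) ⊆ x.2.1.image (Fin.natAdd d) := by
        intro i hi
        rw [Finset.mem_filter] at hi
        have h3 := hcon i hi.1 hi.2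
        have h4 : i = Fin.natAdd d ⟨i.val - d, by omega⟩ := by
          ext; simp; omega
        rw [h4] at h3 ⊢
        exact Finset.mem_image_of_mem _ ((natAdd_mem_range_swapIndex x _).1 h3)
      have h5 := (Finset.card_le_card h2).trans Finset.card_image_le
      rw [x.2.2] at h5
      exact absurd hI (not_lt.2 h5)
    obtain ⟨i, hi, -, hi'⟩ := h1
    have h6 : i ∈ Set.range (Set.powersetCard.ofFinEmbEquiv.symm I) :=
      (Set.powersetCard.mem_range_ofFinEmbEquiv_symm_iff_mem I i).2 hi
    obtain ⟨t, rfl⟩ := h6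
    rw [exteriorPower.basis_apply]
    exact pairing_eq_zero b _ _ t hi'
  | zero => simp
  | add y z _ _ hy hz => rw [map_add, hy, hz, add_zero]
  | smul c y _ hy => rw [map_smul, hy, smul_zero]

theorem homIncl_injective (b : Basis (Fin (d + m)) ℂ V) (s : ℕ) :
    Function.Injective (homIncl b s) := by
  classical
  rw [injective_iff_map_eq_zero]
  intro ψ hψ
  have hc : ∀ x, homCoord b s x ψ = 0 := by
    intro x
    have h1 : (∑ y : MinorIndex d m s, homCoord b s y ψ •
        exteriorPower.ιMulti ℂ d (b ∘ swapIndex y)) ∈ highDeg b s := by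
      rw [← Submodule.ker_mkQ (highDeg b s), LinearMap.mem_ker, map_sum, ← hψ, homIncl]
      simp [truncMap]
    have h2 := pairing_highDeg b x h1
    rw [map_sum, Finset.sum_eq_single x] at h2
    · rw [map_smul, pairing_self b _ (swapIndex_injective x)] at h2
      simpa using h2
    · intro y _ hyx
      have h3 : ∃ i, swapIndex y i ∉ Set.range (swapIndex x) := by
        by_contra! hcon
        have hsub : Set.range (swapIndex y) ⊆ Set.range (swapIndex x) := by
          rintro _ ⟨i, rfl⟩; exact hcon i
        apply hyx
        refine Prod.ext (Subtype.ext ?_) (Subtype.ext ?_)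
        · symm
          refine Finset.eq_of_subset_of_card_le (fun k hk => ?_) (by rw [x.1.2, y.1.2])
          by_contra hk'
          exact (castAdd_mem_range_swapIndex x k).1
            (hsub ((castAdd_mem_range_swapIndex y k).2 hk')) hk
        · refine Finset.eq_of_subset_of_card_le (fun l hl => ?_) (by rw [x.2.2, y.2.2])
          exact (natAdd_mem_range_swapIndex x l).1
            (hsub ((natAdd_mem_range_swapIndex y l).2 hl))
      obtain ⟨i, hi⟩ := h3
      rw [map_smul, pairing_eq_zero b _ _ i hi, smul_zero]
    · intro h; exact absurd (Finset.mem_univ x) h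
  refine ((lowBasis b).exteriorPower s).ext fun J => ?_
  refine ((highBasis b).exteriorPower s).ext_elem fun L => ?_
  have := hc (J, L)
  simpa [homCoord] using this

/-- The embedding `ℙ Hom(Λ^s V_d, Λ^s V_{n-d}) ⊂ ℙ((Λ^d V)_s)`. -/
def homEmb (b : Basis (Fin (d + m)) ℂ V) (s : ℕ) : ℙ ℂ (WedgeHom b s) → ℙ ℂ (TruncWedge b s) :=
  Projectivization.map (homIncl b s) (homIncl_injective b s)

/-- The set of points `[Λ^s φ]`, where `φ : V_d → V_{n-d}` is linear with `Λ^s φ ≠ 0`. -/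
def wedgeLocus (b : Basis (Fin (d + m)) ℂ V) (s : ℕ) : Set (ℙ ℂ (WedgeHom b s)) :=
  {p | ∃ (φ : lowSpace b →ₗ[ℂ] highSpace b) (h : exteriorPower.map s φ ≠ 0),
    p = Projectivization.mk ℂ _ h}

/-! ### The algebra of minors and its projective spectrum -/

section Minors

/-- The `s`-minor, with columns `J` and rows `L`, of the matrix of variables `z_{i,j}`. -/
def minor (d m s : ℕ) (x : MinorIndex d m s) : MvPolynomial (Fin m × Fin d) ℂ :=
  Matrix.det (Matrix.of fun i j : Fin s =>
    MvPolynomial.X (Set.powersetCard.ofFinEmbEquiv.symm x.2 i,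
      Set.powersetCard.ofFinEmbEquiv.symm x.1 j))

/-- The algebra `R_{s;d,m}` generated by all `s`-minors inside the polynomial ring. -/
def minorAlg (d m s : ℕ) : Subalgebra ℂ (MvPolynomial (Fin m × Fin d) ℂ) :=
  Algebra.adjoin ℂ (Set.range (minor d m s))

/-- The grading of the algebra of `s`-minors in which the minors have degree one: the
component of degree `k` consists of the polynomials that are homogeneous of degree `k * s`. -/
def minorGrading (d m s : ℕ) (k : ℕ) : Submodule ℂ (minorAlg d m s) :=
  (MvPolynomial.homogeneousSubmodule (Fin m × Fin d) ℂ (k * s)).comap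
    (minorAlg d m s).val.toLinearMap

theorem minor_mem (d m s : ℕ) (x : MinorIndex d m s) : minor d m s x ∈ minorAlg d m s :=
  Algebra.subset_adjoin (Set.mem_range_self x)

theorem minor_isHomogeneous (d m s : ℕ) (x : MinorIndex d m s) :
    (minor d m s x).IsHomogeneous s := by
  rw [minor, Matrix.det_apply]
  refine MvPolynomial.IsHomogeneous.sum _ _ _ fun σ _ => ?_
  have h : (∏ i : Fin s, (Matrix.of fun i j : Fin s =>
      (MvPolynomial.X (Set.powersetCard.ofFinEmbEquiv.symm x.2 i,
        Set.powersetCard.ofFinEmbEquiv.symm x.1 j) : MvPolynomial (Fin m × Fin d) ℂ))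
          (σ i) i).IsHomogeneous (∑ _i : Fin s, 1) :=
    MvPolynomial.IsHomogeneous.prod _ _ _ fun i _ => MvPolynomial.isHomogeneous_X _ _
  rw [Finset.sum_const, Finset.card_univ, Fintype.card_fin, smul_eq_mul, mul_one] at h
  rcases Int.units_eq_one_or (Equiv.Perm.sign σ) with h1 | h1
  · rw [h1, one_smul]; exact h
  · rw [h1, Units.neg_smul, one_smul]; exact h.neg

theorem mem_minorGrading {d m s k : ℕ} {f : minorAlg d m s} :
    f ∈ minorGrading d m s k ↔ (f : MvPolynomial (Fin m × Fin d) ℂ).IsHomogeneous (k * s) :=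
  Iff.rfl

instance minorGrading_gradedMonoid (d m s : ℕ) : SetLike.GradedMonoid (minorGrading d m s) where
  one_mem := by
    rw [mem_minorGrading, zero_mul]
    exact MvPolynomial.isHomogeneous_one _ _
  mul_mem := by
    intro i j f g hf hg
    rw [mem_minorGrading] at *
    rw [add_mul]
    exact hf.mul hg

theorem minorGrading_isInternal (d m : ℕ) {s : ℕ} (hs : s ≠ 0) :
    DirectSum.IsInternal (minorGrading d m s) := by
  classical
  rw [DirectSum.isInternal_submodule_iff_iSupIndep_and_iSup_eq_top]
  constructor
  · have h1 : iSupIndep (MvPolynomial.homogeneousSubmodule (Fin m × Fin d) ℂ) :=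
      letI := MvPolynomial.gradedAlgebra (σ := Fin m × Fin d) (R := ℂ)
      (DirectSum.Decomposition.isInternal
        (MvPolynomial.homogeneousSubmodule (Fin m × Fin d) ℂ)).submodule_iSupIndep
    have h2 : Function.Injective fun k : ℕ => k * s := fun a b h =>
      Nat.eq_of_mul_eq_mul_right (Nat.pos_of_ne_zero hs) h
    have h3 := h1.comp h2
    rw [iSupIndep_def] at h3 ⊢
    intro i
    rw [Submodule.disjoint_def]
    intro f hf hf'
    have hg : ((minorAlg d m s).val.toLinearMap f) ∈
        ⨆ j, ⨆ (_ : j ≠ i), MvPolynomial.homogeneousSubmodule (Fin m × Fin d) ℂ (j * s) := by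
      have h4 := Submodule.mem_map_of_mem (f := (minorAlg d m s).val.toLinearMap) hf'
      rw [Submodule.map_iSup] at h4
      refine (iSup_mono fun j => ?_ :
        (⨆ j, Submodule.map (minorAlg d m s).val.toLinearMap
          (⨆ (_ : j ≠ i), minorGrading d m s j)) ≤ _) h4
      rw [Submodule.map_iSup]
      exact iSup_mono fun _ => Submodule.map_comap_le _ _
    have := (Submodule.disjoint_def.1 (h3 i)) _ hf hg
    exact Subtype.ext this
  · rw [eq_top_iff]
    rintro ⟨f, hf⟩ -
    induction hf using Algebra.adjoin_induction with
    | mem x hx =>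
      obtain ⟨i, rfl⟩ := hx
      refine Submodule.mem_iSup_of_mem 1 ?_
      rw [mem_minorGrading, one_mul]
      exact minor_isHomogeneous d m s i
    | algebraMap c =>
      refine Submodule.mem_iSup_of_mem 0 ?_
      rw [mem_minorGrading, zero_mul]
      exact MvPolynomial.isHomogeneous_C _ c
    | add x y hx hy h1 h2 => exact Submodule.add_mem _ h1 h2
    | mul x y hx hy h1 h2 =>
      have key : ∀ a ∈ ⨆ k, minorGrading d m s k, ∀ c ∈ ⨆ k, minorGrading d m s k,
          a * c ∈ ⨆ k, minorGrading d m s k := by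
        intro a ha c hc
        induction ha using Submodule.iSup_induction' with
        | mem i u hu =>
          induction hc using Submodule.iSup_induction' with
          | mem j w hw => exact Submodule.mem_iSup_of_mem (i + j) (SetLike.mul_mem_graded hu hw)
          | zero => rw [mul_zero]; exact Submodule.zero_mem _
          | add w w' _ _ h h' => rw [mul_add]; exact Submodule.add_mem _ h h'
        | zero => rw [zero_mul]; exact Submodule.zero_mem _
        | add w w' _ _ h h' => rw [add_mul]; exact Submodule.add_mem _ h h'
      have h3 : (⟨x * y, (minorAlg d m s).mul_mem hx hy⟩ : minorAlg d m s) =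
          (⟨x, hx⟩ : minorAlg d m s) * (⟨y, hy⟩ : minorAlg d m s) := Subtype.ext rfl
      have h4 := key ⟨x, hx⟩ h1 ⟨y, hy⟩ h2
      rw [← h3] at h4
      exact h4

/-- For `s ≠ 0` the algebra of `s`-minors is a graded algebra. -/
@[reducible] def minorGradedAlgebra (d m : ℕ) {s : ℕ} (hs : s ≠ 0) :
    GradedAlgebra (minorGrading d m s) :=
  { minorGrading_gradedMonoid d m s with
    toDecomposition := (minorGrading_isInternal d m hs).chooseDecomposition }

/-- The projective spectrum `Proj(R_{s;d,m})` of the algebra of `s`-minors. -/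
def minorProj (d m : ℕ) {s : ℕ} (hs : s ≠ 0) : Scheme :=
  letI := minorGradedAlgebra d m hs
  Proj (minorGrading d m s)

/-- The homogeneous coordinate ring of `ℙ Hom(Λ^s V_d, Λ^s V_{n-d})`, with its grading. -/
abbrev homGrading (d m s : ℕ) (k : ℕ) : Submodule ℂ (MvPolynomial (MinorIndex d m s) ℂ) :=
  MvPolynomial.homogeneousSubmodule (MinorIndex d m s) ℂ k

attribute [local instance] MvPolynomial.gradedAlgebra

/-- The scheme `ℙ Hom(Λ^s V_d, Λ^s V_{n-d})`. -/
def homProj (d m s : ℕ) : Scheme := Proj (homGrading d m s)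

/-- The homomorphism from the polynomial ring to the algebra of minors that sends the variable
with index `(J, L)` to the corresponding minor. -/
def minorHom (d m s : ℕ) : MvPolynomial (MinorIndex d m s) ℂ →ₐ[ℂ] minorAlg d m s :=
  MvPolynomial.aeval fun x => ⟨minor d m s x, minor_mem d m s x⟩

theorem minorHom_mem (d m s : ℕ) {k : ℕ} {F : MvPolynomial (MinorIndex d m s) ℂ}
    (hF : F ∈ homGrading d m s k) : minorHom d m s F ∈ minorGrading d m s k := by
  have h : ((minorHom d m s F : minorAlg d m s) : MvPolynomial (Fin m × Fin d) ℂ) =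
      MvPolynomial.aeval (minor d m s) F := by
    have := MvPolynomial.map_aeval (fun x => (⟨minor d m s x, minor_mem d m s x⟩ : minorAlg d m s))
      (minorAlg d m s).val.toRingHom F
    rw [MvPolynomial.aeval_def]
    exact this
  rw [mem_minorGrading, h, mul_comm]
  exact MvPolynomial.IsHomogeneous.aeval hF _ fun i => minor_isHomogeneous d m s i

theorem minorHom_surjective (d m s : ℕ) : Function.Surjective (minorHom d m s) := by
  rintro ⟨f, hf⟩
  induction hf using Algebra.adjoin_induction with
  | mem x hx =>
    obtain ⟨i, rfl⟩ := hx
    exact ⟨MvPolynomial.X i, by simp [minorHom]⟩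
  | algebraMap c => exact ⟨MvPolynomial.C c, by simp [minorHom]; rfl⟩
  | add x y hx hy h1 h2 =>
    obtain ⟨a, ha⟩ := h1
    obtain ⟨c, hc⟩ := h2
    exact ⟨a + c, by rw [map_add, ha, hc]; rfl⟩
  | mul x y hx hy h1 h2 =>
    obtain ⟨a, ha⟩ := h1
    obtain ⟨c, hc⟩ := h2
    exact ⟨a * c, by rw [map_mul, ha, hc]; rfl⟩

/-- `minorHom` as a homomorphism of graded rings. -/
def minorGradedHom (d m : ℕ) (s : ℕ) : homGrading d m s →+*ᵍ minorGrading d m s :=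
  { (minorHom d m s).toRingHom with
    map_mem := fun h => minorHom_mem d m s h }

theorem irrelevant_le (d m : ℕ) {s : ℕ} (hs : s ≠ 0) :
    letI := minorGradedAlgebra d m hs
    HomogeneousIdeal.irrelevant (minorGrading d m s) ≤
      (HomogeneousIdeal.irrelevant (homGrading d m s)).map (minorGradedHom d m s) := by
  let _ := minorGradedAlgebra d m hs
  rw [HomogeneousIdeal.irrelevant_le]
  intro k hk f hf
  obtain ⟨F, rfl⟩ := minorHom_surjective d m s f
  have h : minorGradedHom d m s (DirectSum.decompose (homGrading d m s) F k) =
      minorHom d m s F := by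
    rw [GradedRingHom.map_directSumDecompose]
    exact DirectSum.decompose_of_mem_same _ hf
  have h2 : minorGradedHom d m s (DirectSum.decompose (homGrading d m s) F k) ∈
      (HomogeneousIdeal.irrelevant (homGrading d m s)).map (minorGradedHom d m s) :=
    Ideal.mem_map_of_mem (minorGradedHom d m s)
      (HomogeneousIdeal.mem_irrelevant_of_mem (homGrading d m s) hk (SetLike.coe_mem _))
  rw [h] at h2
  exact h2

/-- The morphism `Proj(R_{s;d,m}) ⟶ ℙ Hom(Λ^s V_d, Λ^s V_{n-d})` given by the minors. -/
def minorProjEmb (d m : ℕ) {s : ℕ} (hs : s ≠ 0) : minorProj d m hs ⟶ homProj d m s :=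
  letI := minorGradedAlgebra d m hs
  Proj.map (minorGradedHom d m s) (irrelevant_le d m hs)

/-- The homogeneous ideal of a point of the scheme `ℙ Hom(Λ^s V_d, Λ^s V_{n-d})`. -/
def pointIdeal {d m s : ℕ} (y : homProj d m s) : Ideal (MvPolynomial (MinorIndex d m s) ℂ) :=
  (show ProjectiveSpectrum (homGrading d m s) from y).asHomogeneousIdeal.toIdeal

end Minors

/-- The variety `Proj(R_{s;d,m})` inside the classical projective space
`ℙ Hom(Λ^s V_d, Λ^s V_{n-d})`: a point `[ψ]` belongs to it if the image of the morphism
`minorProjEmb` contains the closed point `[ψ]` of the scheme, i.e. the one whose homogeneous ideal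
consists of the polynomials that vanish at `[ψ]`. -/
def minorVariety (b : Basis (Fin (d + m)) ℂ V) {s : ℕ} (hs : s ≠ 0) :
    Set (ℙ ℂ (WedgeHom b s)) :=
  {p | ∃ x : minorProj d m hs, ∀ (k : ℕ) (F : MvPolynomial (MinorIndex d m s) ℂ),
    F.IsHomogeneous k →
      (F ∈ pointIdeal (minorProjEmb d m hs x) ↔
        MvPolynomial.eval (fun i => homCoord b s i p.rep) F = 0)}

/-- `Gr_d(V) ∖ S_s` as a set of points of the Plücker space `ℙ(Λ^d V)`. -/
def openPart (b : Basis (Fin (d + m)) ℂ V) (s : ℕ) : Set (ℙ ℂ (⋀[ℂ]^d V)) :=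
  plucker b '' (schubert b s)ᶜ

/-- The restriction to `Gr_d(V) ∖ S_s` of the projection `ℙ(Λ^d V) ⇢ ℙ((Λ^d V)_s)`, given that
the projection is defined there. -/
def truncProj (b : Basis (Fin (d + m)) ℂ V) (s : ℕ)
    (h : openPart b s ⊆ projDomain (truncMap b s)) (p : openPart b s) :
    ℙ ℂ (TruncWedge b s) :=
  linProj (truncMap b s) ⟨p.1, h p.2⟩

end TruncGr

end

/-! Write `s = r - 1`. The Plücker coordinates on `⋀^d V` are graded by the number of indices beyond
the first `d`, and the projection to `(Λ^d V)_s` keeps exactly those of degree at most `s`. Choosing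
a basis of `U^*` among the coordinate functionals, low ones first, shows that the least degree of a
nonvanishing Plücker coordinate of `U` is `dim (U ∩ V_{n-d})` (`finrank_inf_highSpace_le`,
`exists_plCoord_ne_zero`). So the complement of `S_s` is the locus where some coordinate of degree
less than `s` is nonzero.

On the chart `p_f ≠ 0` the subspace is spanned by vectors whose coefficients are the `p_{f'}`, where
`f'` differs from `f` in one index. If `f` has degree less than `s`, every such `f'` has degree at
most `s`, so these vectors can be read off after truncation. By Cramer's rule their wedge product is
`p_f ^ (d - 1)` times the original decomposable vector (`chartVec_truncMap`). This gives a
polynomial inverse of the projection. The same formula is an identity between forms on the orbit,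
hence on its closure. Therefore the image is exactly the part of `X_s` where some coordinate of
degree less than `s` is nonzero (`mem_range_truncProj_iff_mem_truncGr`); that it lies in `X_s` at
all uses the density of the big cell (`form_eq_zero_of_graphFam`).

The rest of `X_s` lies in the degree `s` part, which is `ℙ Hom(Λ^s V_d, Λ^s V_{n-d})`. The orbit
consists of graphs of matrices `M`, whose degree `s` coordinates are the `s`-minors of `M`. A
homogeneous relation between the minors is thus a form vanishing on the orbit, so it vanishes on
`X_s`. Conversely, replacing `M` by `u⁻¹ M`, multiplying by `u ^ s` and letting `u → 0` isolates
`Λ^s M`, so a form vanishing on the orbit restricts to a relation between minors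
(`form_scaledTrunc_zero_eq_zero`). Hence the rest is the zero locus of the relations, which is
`Proj` of the algebra of minors (`mem_image_minorVariety_iff`). The closed immersion comes from that
algebra being a graded quotient of a polynomial ring. -/

noncomputable section

namespace TruncGr

/-! ### Closed immersions of `Proj` from graded surjections -/

section ProjClosedImmersion

open CategoryTheory HomogeneousLocalization HomogeneousIdeal

universe u

variable {A B σ τ : Type u} [CommRing A] [SetLike σ A] [AddSubgroupClass σ A]
  [CommRing B] [SetLike τ B] [AddSubgroupClass τ B]
  {𝒜 : ℕ → σ} {ℬ : ℕ → τ} [GradedRing 𝒜] [GradedRing ℬ]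

/-- A surjective graded homomorphism is surjective in each degree. -/
theorem gradedHom_surjective_of_mem (f : 𝒜 →+*ᵍ ℬ) (hf : Function.Surjective f) {k : ℕ} {y : B}
    (hy : y ∈ ℬ k) : ∃ x ∈ 𝒜 k, f x = y := by
  obtain ⟨x, rfl⟩ := hf y
  refine ⟨DirectSum.decompose 𝒜 x k, SetLike.coe_mem _, ?_⟩
  rw [GradedRingHom.map_directSumDecompose]
  exact DirectSum.decompose_of_mem_same _ hy

/-- A fraction `z / f(a) ^ n` of degree zero lifts by lifting its numerator within its own degree.
-/
theorem awayMap_surjective (f : 𝒜 →+*ᵍ ℬ) (hf : Function.Surjective f) {k : ℕ} {a : A}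
    (ha : a ∈ 𝒜 k) : Function.Surjective (Away.map f a) := by
  intro y
  obtain ⟨n, z, hz, rfl⟩ := Away.mk_surjective (𝒜 := ℬ) (f.2 ha) y
  obtain ⟨x, hx, rfl⟩ := gradedHom_surjective_of_mem f hf hz
  exact ⟨Away.mk 𝒜 ha n x hx, by rw [Away.map_mk]⟩

/-- A surjective graded homomorphism induces a closed immersion of projective spectra. -/
theorem isClosedImmersion_projMap (f : 𝒜 →+*ᵍ ℬ) (hf : Function.Surjective f)
    (h : irrelevant ℬ ≤ (irrelevant 𝒜).map f) : IsClosedImmersion (Proj.map f h) := by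
  refine IsZariskiLocalAtTarget.of_openCover (Proj.affineOpenCover 𝒜).openCover ?_
  rintro (⟨k, a⟩ : (k : ℕ+) × ↥(𝒜 ↑k))
  -- The preimage of `D₊(a)` is `D₊(f a)`, so over this chart the morphism is `Spec` of the
  -- surjection `Away.map f a`.
  have hP := IsOpenImmersion.isPullback
    (Spec.map (CommRingCat.ofHom (Away.map f (a : A))))
    (Proj.awayι ℬ (f (a : A)) (f.2 a.2) k.pos) (Proj.awayι 𝒜 (a : A) a.2 k.pos) (Proj.map f h)
    (Proj.awayι_comp_map f h k.pos _ a.2)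
    (by rw [Proj.opensRange_awayι, Proj.opensRange_awayι, Proj.map_preimage_basicOpen])
  have hc : IsClosedImmersion (Spec.map (CommRingCat.ofHom (Away.map f (a : A)))) :=
    IsClosedImmersion.spec_of_surjective _ (awayMap_surjective f hf a.2)
  have h2 : IsClosedImmersion (hP.flip.isoPullback.inv ≫
      Spec.map (CommRingCat.ofHom (Away.map f (a : A)))) := inferInstance
  rw [hP.flip.isoPullback_inv_snd] at h2
  exact h2

end ProjClosedImmersion

/-! ### Points of `Proj` of the algebra of minors -/

section MinorScheme

attribute [local instance] MvPolynomial.gradedAlgebra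

theorem isClosedImmersion_minorProjEmb (d m : ℕ) {s : ℕ} (hs : s ≠ 0) :
    IsClosedImmersion (minorProjEmb d m hs) := by
  let _ := minorGradedAlgebra d m hs
  exact isClosedImmersion_projMap (minorGradedHom d m s) (minorHom_surjective d m s)
    (irrelevant_le d m hs)

/-- True by definition: `Proj.map` sends a homogeneous prime to its preimage. -/
theorem mem_pointIdeal_minorProjEmb {d m s : ℕ} (hs : s ≠ 0) (x : minorProj d m hs)
    (F : MvPolynomial (MinorIndex d m s) ℂ) :
    letI := minorGradedAlgebra d m hs
    F ∈ pointIdeal (minorProjEmb d m hs x) ↔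
      minorHom d m s F ∈ (show ProjectiveSpectrum (minorGrading d m s) from x).asHomogeneousIdeal :=
  Iff.rfl

/-- If all homogeneous relations between the minors vanish at `c`, then so do all relations. -/
theorem eval_eq_zero_of_minorHom_eq_zero {d m s : ℕ} (hs : s ≠ 0) (c : MinorIndex d m s → ℂ)
    (hc : ∀ (k : ℕ) (F : MvPolynomial (MinorIndex d m s) ℂ), F.IsHomogeneous k →
      minorHom d m s F = 0 → MvPolynomial.eval c F = 0)
    {F : MvPolynomial (MinorIndex d m s) ℂ} (hF : minorHom d m s F = 0) :
    MvPolynomial.eval c F = 0 := by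
  classical
  let _ := minorGradedAlgebra d m hs
  -- The kernel of a graded homomorphism is homogeneous: each component of `F` is again a relation.
  rw [← DirectSum.sum_support_decompose (homGrading d m s) F, map_sum]
  refine Finset.sum_eq_zero fun k _ =>
    hc k _ (DirectSum.decompose (homGrading d m s) F k).2 ?_
  change minorGradedHom d m s _ = 0
  rw [GradedRingHom.map_directSumDecompose]
  change ((DirectSum.decompose (minorGrading d m s) (minorHom d m s F) k : minorAlg d m s)) = 0
  rw [hF]
  simp

/-- A point `c ≠ 0` at which all homogeneous relations between the minors vanish gives a point of
`Proj(R_{s;d,m})`. -/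
theorem exists_minorProj_point {d m s : ℕ} (hs : s ≠ 0) (c : MinorIndex d m s → ℂ) (hc0 : c ≠ 0)
    (hc : ∀ (k : ℕ) (F : MvPolynomial (MinorIndex d m s) ℂ), F.IsHomogeneous k →
      minorHom d m s F = 0 → MvPolynomial.eval c F = 0) :
    ∃ x : minorProj d m hs, ∀ (k : ℕ) (F : MvPolynomial (MinorIndex d m s) ℂ),
      F.IsHomogeneous k →
        (F ∈ pointIdeal (minorProjEmb d m hs x) ↔ MvPolynomial.eval c F = 0) := by
  let _ := minorGradedAlgebra d m hs
  let φ : MvPolynomial (MinorIndex d m s) ℂ →+* minorAlg d m s := (minorHom d m s).toRingHom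
  have hφ : Function.Surjective φ := minorHom_surjective d m s
  -- `K` is the prime ideal of the affine point `c`. It contains all relations, so its image in the
  -- algebra of minors is prime; the homogeneous core of that image is the ideal of the line through
  -- `c`.
  let K : Ideal (MvPolynomial (MinorIndex d m s) ℂ) := RingHom.ker (MvPolynomial.eval c)
  have hker : RingHom.ker φ ≤ K := fun F hF =>
    eval_eq_zero_of_minorHom_eq_zero hs c hc hF
  have hK : K.IsPrime := RingHom.ker_isPrime _
  have hq : (K.map φ).IsPrime := Ideal.map_isPrime_of_surjective hφ hker
  have hmem : ∀ F, φ F ∈ K.map φ ↔ MvPolynomial.eval c F = 0 := by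
    intro F
    rw [← Ideal.mem_comap, Ideal.comap_map_of_surjective' φ hφ, sup_eq_left.2 hker]
    rfl
  have hmem2 : ∀ (k : ℕ) (F : MvPolynomial (MinorIndex d m s) ℂ), F.IsHomogeneous k →
      (φ F ∈ (K.map φ).homogeneousCore (minorGrading d m s) ↔ MvPolynomial.eval c F = 0) := by
    intro k F hF
    rw [← hmem]
    exact ⟨fun h => Ideal.toIdeal_homogeneousCore_le _ _ h, fun h =>
      Ideal.mem_homogeneousCore_of_homogeneous_of_mem ⟨k, minorHom_mem d m s hF⟩ h⟩
  -- If this prime contained the irrelevant ideal, every variable would vanish at `c`, contradicting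
  -- `c ≠ 0`.
  refine ⟨(⟨(K.map φ).homogeneousCore (minorGrading d m s), hq.homogeneousCore, fun hle => ?_⟩ :
    ProjectiveSpectrum (minorGrading d m s)), fun k F hF => hmem2 k F hF⟩
  apply hc0
  funext i
  have h1 : (MvPolynomial.X i : MvPolynomial (MinorIndex d m s) ℂ).IsHomogeneous 1 :=
    MvPolynomial.isHomogeneous_X _ _
  have h2 := (hmem2 1 _ h1).1 (hle (HomogeneousIdeal.mem_irrelevant_of_mem (minorGrading d m s)
    one_pos (minorHom_mem d m s h1)))
  simpa using h2

theorem eval_minor (d m s : ℕ) (z : Fin m × Fin d → ℂ) (F : MvPolynomial (MinorIndex d m s) ℂ) :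
    MvPolynomial.eval z (minorHom d m s F : MvPolynomial (Fin m × Fin d) ℂ) =
      MvPolynomial.eval (fun x => MvPolynomial.eval z (minor d m s x)) F := by
  induction F using MvPolynomial.induction_on with
  | C c =>
    have : (minorHom d m s (MvPolynomial.C c) : MvPolynomial (Fin m × Fin d) ℂ) =
      MvPolynomial.C c := by simp [minorHom]
    rw [this]; simp
  | add p q hp hq => simp [hp, hq]
  | mul_X p i hp => 
    have hX : (minorHom d m s (MvPolynomial.X i) : MvPolynomial (Fin m × Fin d) ℂ) =
      minor d m s i := by simp [minorHom]
    simp [hp, hX]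

/-- Since `ℂ` is infinite, a polynomial in the `z_{i,j}` is determined by its values, so relations
can be tested on numerical matrices. -/
theorem minorHom_eq_zero_iff {d m s : ℕ} (F : MvPolynomial (MinorIndex d m s) ℂ) :
    minorHom d m s F = 0 ↔ ∀ z : Fin m × Fin d → ℂ,
      MvPolynomial.eval (fun x => MvPolynomial.eval z (minor d m s x)) F = 0 := by
  constructor
  · intro h z
    rw [← eval_minor, h]; simp
  · intro h
    refine Subtype.ext (MvPolynomial.funext fun z => ?_)
    rw [eval_minor, h]; simp

end MinorScheme

/-! ### The variety of the algebra of minors -/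

section MinorVariety

variable {V : Type*} [AddCommGroup V] [Module ℂ V] {d m : ℕ}

theorem homCoord_ext (b : Basis (Fin (d + m)) ℂ V) {s : ℕ} {ψ χ : WedgeHom b s}
    (h : ∀ x, homCoord b s x ψ = homCoord b s x χ) : ψ = χ := by
  refine ((lowBasis b).exteriorPower s).ext fun J => ?_
  refine ((highBasis b).exteriorPower s).ext_elem fun L => ?_
  simpa [homCoord] using h (J, L)

/-- `Proj(R_{s;d,m})` as a variety is cut out by the homogeneous relations between the minors. -/
theorem mem_minorVariety_iff (b : Basis (Fin (d + m)) ℂ V) {s : ℕ} (hs : s ≠ 0)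
    (p : ℙ ℂ (WedgeHom b s)) :
    p ∈ minorVariety b hs ↔ ∀ (k : ℕ) (F : MvPolynomial (MinorIndex d m s) ℂ),
      F.IsHomogeneous k → (∀ z : Fin m × Fin d → ℂ,
        MvPolynomial.eval (fun x => MvPolynomial.eval z (minor d m s x)) F = 0) →
      MvPolynomial.eval (fun i => homCoord b s i p.rep) F = 0 := by
  simp only [← minorHom_eq_zero_iff]
  constructor
  · rintro ⟨x, hx⟩ k F hF hF0
    rw [← hx k F hF, mem_pointIdeal_minorProjEmb, hF0]
    exact Ideal.zero_mem _
  · intro h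
    refine exists_minorProj_point hs _ (fun h0 => p.rep_nonzero ?_) h
    refine homCoord_ext b fun x => ?_
    rw [map_zero]
    exact congrFun h0 x

end MinorVariety

/-! ### Homogeneous forms and the Zariski closure -/

section Forms

variable {W W' : Type*} [AddCommGroup W] [Module ℂ W] [AddCommGroup W'] [Module ℂ W']

/-- `f` is a homogeneous polynomial function of degree `k` on `W`. -/
def IsForm (k : ℕ) (f : W → ℂ) : Prop :=
  ∃ P : MvPolynomial (Module.Dual ℂ W) ℂ, P.IsHomogeneous k ∧ ∀ w, f w = polyVal P w

theorem IsForm.const (c : ℂ) : IsForm 0 (fun _ : W => c) :=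
  ⟨MvPolynomial.C c, MvPolynomial.isHomogeneous_C _ c, fun w => by simp [polyVal]⟩

theorem IsForm.dual (l : Module.Dual ℂ W) : IsForm 1 (fun w => l w) :=
  ⟨MvPolynomial.X l, MvPolynomial.isHomogeneous_X _ l, fun w => by simp [polyVal]⟩

theorem IsForm.sub {k : ℕ} {f g : W → ℂ} (hf : IsForm k f) (hg : IsForm k g) :
    IsForm k (fun w => f w - g w) := by
  obtain ⟨P, hP, hP'⟩ := hf
  obtain ⟨Q, hQ, hQ'⟩ := hg
  exact ⟨P - Q, hP.sub hQ, fun w => by simp [polyVal, hP', hQ']⟩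

theorem IsForm.mul {k l : ℕ} {f g : W → ℂ} (hf : IsForm k f) (hg : IsForm l g) :
    IsForm (k + l) (fun w => f w * g w) := by
  obtain ⟨P, hP, hP'⟩ := hf
  obtain ⟨Q, hQ, hQ'⟩ := hg
  exact ⟨P * Q, hP.mul hQ, fun w => by simp [polyVal, hP', hQ']⟩

theorem IsForm.mul_const {k : ℕ} {f : W → ℂ} (hf : IsForm k f) (c : ℂ) :
    IsForm k (fun w => f w * c) := hf.mul (IsForm.const c)

theorem IsForm.pow {k : ℕ} {f : W → ℂ} (hf : IsForm k f) (n : ℕ) :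
    IsForm (k * n) (fun w => f w ^ n) := by
  obtain ⟨P, hP, hP'⟩ := hf
  exact ⟨P ^ n, hP.pow n, fun w => by simp [polyVal, hP']⟩

theorem IsForm.sum {ι : Type*} {k : ℕ} (S : Finset ι) {f : ι → W → ℂ}
    (hf : ∀ i, IsForm k (f i)) : IsForm k (fun w => ∑ i ∈ S, f i w) := by
  choose P hP hP' using hf
  exact ⟨∑ i ∈ S, P i, MvPolynomial.IsHomogeneous.sum _ _ _ fun i _ => hP i,
    fun w => by simp [polyVal, hP']⟩

theorem IsForm.prod_dual {ι : Type*} (S : Finset ι) (l : ι → Module.Dual ℂ W) :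
    IsForm S.card (fun w => ∏ i ∈ S, l i w) := by
  refine ⟨∏ i ∈ S, MvPolynomial.X (l i), ?_, fun w => by simp [polyVal]⟩
  have := MvPolynomial.IsHomogeneous.prod S (fun i => (MvPolynomial.X (l i) :
    MvPolynomial (Module.Dual ℂ W) ℂ)) (fun _ => 1) fun i _ => MvPolynomial.isHomogeneous_X _ _
  simpa using this

theorem IsForm.eval {ι : Type*} {k : ℕ} {P : MvPolynomial ι ℂ} (hP : P.IsHomogeneous k)
    (l : ι → Module.Dual ℂ W) : IsForm k (fun w => MvPolynomial.eval (fun i => l i w) P) :=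
  ⟨MvPolynomial.rename l P, hP.rename_isHomogeneous, fun w => by
    rw [polyVal, MvPolynomial.eval_rename]; rfl⟩

theorem eval_algHom {ι B : Type*} [CommRing B] [Algebra ℂ B] (φ : B →ₐ[ℂ] ℂ) (q : ι → B)
    (P : MvPolynomial ι ℂ) :
    MvPolynomial.eval (fun i => φ (q i)) P = φ (MvPolynomial.aeval q P) := by
  rw [MvPolynomial.comp_aeval_apply]
  rfl

theorem IsForm.comp {k l : ℕ} {f : W' → ℂ} (hf : IsForm k f) {G : W → W'}
    (hG : IsHomogPolyMap l G) : IsForm (l * k) (fun w => f (G w)) := by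
  obtain ⟨P, hP, hP'⟩ := hf
  choose Q hQ hQ' using hG
  refine ⟨MvPolynomial.aeval Q P, hP.aeval _ hQ, fun w => ?_⟩
  have : (fun x : Module.Dual ℂ W' => x (G w)) = fun x => polyVal (Q x) w :=
    funext fun x => hQ' x w
  change f (G w) = _
  rw [hP', polyVal, polyVal, this]
  exact eval_algHom (MvPolynomial.aeval fun l : Module.Dual ℂ W => l w) Q P

theorem IsForm.smul {k : ℕ} {f : W → ℂ} (hf : IsForm k f) (c : ℂ) (w : W) :
    f (c • w) = c ^ k * f w := by
  obtain ⟨P, hP, hP'⟩ := hf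
  rw [hP', hP', polyVal, polyVal, MvPolynomial.eval_eq, MvPolynomial.eval_eq, Finset.mul_sum]
  refine Finset.sum_congr rfl fun e he => ?_
  simp only [map_smul, smul_eq_mul, mul_pow, Finset.prod_mul_distrib, Finset.prod_pow_eq_pow_sum]
  rw [hP.degree_eq_sum_deg_support he]
  ring

/-- Vanishing of a form does not depend on the chosen representative, so `rep` can be traded for any
convenient vector. -/
theorem IsForm.eq_zero_iff_rep {k : ℕ} {f : W → ℂ} (hf : IsForm k f) {w : W} (hw : w ≠ 0) :
    f (Projectivization.mk ℂ w hw).rep = 0 ↔ f w = 0 := by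
  obtain ⟨a, ha⟩ := Projectivization.exists_smul_eq_mk_rep ℂ w hw
  rw [← ha, Units.smul_def, hf.smul]
  simp

/-- Along a polynomial curve a form is a polynomial in the parameter. -/
theorem IsForm.exists_polynomial {k : ℕ} {f : W → ℂ} (hf : IsForm k f) {w : ℂ → W}
    (hw : ∀ l : Module.Dual ℂ W, ∃ p : Polynomial ℂ, ∀ t, l (w t) = p.eval t) :
    ∃ p : Polynomial ℂ, ∀ t, f (w t) = p.eval t := by
  obtain ⟨P, -, hP'⟩ := hf
  choose q hq using hw
  refine ⟨MvPolynomial.aeval q P, fun t => ?_⟩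
  have : (fun l : Module.Dual ℂ W => l (w t)) = fun l => (q l).eval t := funext fun l => hq l t
  rw [hP', polyVal, this]
  simp only [← Polynomial.coe_aeval_eq_eval]
  exact eval_algHom (Polynomial.aeval t) q P

/-- In terms of a finite family of vectors a form is a homogeneous polynomial in the
coefficients. -/
theorem IsForm.exists_mvPolynomial {ι : Type*} [Fintype ι] {k : ℕ} {f : W → ℂ} (hf : IsForm k f)
    (e : ι → W) : ∃ P : MvPolynomial ι ℂ, P.IsHomogeneous k ∧
      ∀ x : ι → ℂ, f (∑ i, x i • e i) = MvPolynomial.eval x P := by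
  obtain ⟨P, hP, hP'⟩ := hf
  let q : Module.Dual ℂ W → MvPolynomial ι ℂ := fun l =>
    ∑ i, MvPolynomial.C (l (e i)) * MvPolynomial.X i
  refine ⟨MvPolynomial.aeval q P, ?_, fun x => ?_⟩
  · have := hP.aeval q (n := 1) fun l =>
      MvPolynomial.IsHomogeneous.sum _ _ _ fun i _ => MvPolynomial.isHomogeneous_C_mul_X _ _
    simpa using this
  · have : (fun l : Module.Dual ℂ W => l (∑ i, x i • e i)) =
        fun l => MvPolynomial.aeval x (q l) :=
      funext fun l => by simp [q, mul_comm]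
    rw [hP', polyVal, this]
    exact eval_algHom (MvPolynomial.aeval x) q P

theorem isHomogPolyMap_linear (q : W →ₗ[ℂ] W') : IsHomogPolyMap 1 q :=
  fun l => IsForm.dual (l.comp q)

/-- Products of forms are forms, so the generating sets are already stable under finite
intersections. -/
theorem isTopologicalBasis_zariski :
    @TopologicalSpace.IsTopologicalBasis _ (zariski W)
    {O | ∃ (k : ℕ) (f : W → ℂ), IsForm k f ∧ O = {p : ℙ ℂ W | f p.rep ≠ 0}} := by
  let _ := zariski W
  refine TopologicalSpace.isTopologicalBasis_of_subbasis_of_finiteInter ?_ ⟨?_, ?_⟩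
  · refine congrArg TopologicalSpace.generateFrom (Set.ext fun O => ⟨?_, ?_⟩)
    · rintro ⟨k, F, hF, rfl⟩
      exact ⟨k, polyVal F, ⟨F, hF, fun _ => rfl⟩, rfl⟩
    · rintro ⟨k, f, ⟨F, hF, hf⟩, rfl⟩
      exact ⟨k, F, hF, by simp only [hf]⟩
  · exact ⟨0, fun _ => 1, IsForm.const 1, by simp⟩
  · rintro _ ⟨k, f, hf, rfl⟩ _ ⟨l, g, hg, rfl⟩
    refine ⟨k + l, _, hf.mul hg, ?_⟩
    ext p
    simp [not_or]

theorem mem_closure_zariski_iff {A : Set (ℙ ℂ W)} {p : ℙ ℂ W} :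
    p ∈ closure[zariski W] A ↔ ∀ (k : ℕ) (f : W → ℂ), IsForm k f → (∀ a ∈ A, f a.rep = 0) →
      f p.rep = 0 := by
  rw [@TopologicalSpace.IsTopologicalBasis.mem_closure_iff _ (zariski W) _
    isTopologicalBasis_zariski]
  constructor
  · intro h k f hf h0
    by_contra hp
    obtain ⟨a, ha, haA⟩ := h _ ⟨k, f, hf, rfl⟩ hp
    exact ha (h0 a haA)
  · rintro h _ ⟨k, f, hf, rfl⟩ hp
    by_contra hne
    exact hp (h k f hf fun a ha => by
      by_contra hfa
      exact hne ⟨a, hfa, ha⟩)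

/-- The locus in `B` where at least one of a family of forms does not vanish is open in `B`. -/
theorem isOpenIn_of_forms {ι : Type*} {A B : Set (ℙ ℂ W)} (S : Set ι) {k : ℕ} {f : ι → W → ℂ}
    (hf : ∀ i ∈ S, IsForm k (f i)) (h : ∀ p, p ∈ A ↔ p ∈ B ∧ ∃ i ∈ S, f i p.rep ≠ 0) :
    IsOpenIn A B := by
  refine ⟨⋃ i ∈ S, {p | f i p.rep ≠ 0}, ?_, ?_⟩
  · let _ := zariski W
    exact isOpen_biUnion fun i hi => isTopologicalBasis_zariski.isOpen ⟨k, f i, hf i hi, rfl⟩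
  · ext p
    simp [h]

end Forms

/-! ### Plücker coordinates, their degrees, and reconstruction in a chart -/

section PluckerCoordinates

variable {V : Type*} [AddCommGroup V] [Module ℂ V] {d m : ℕ}

/-- The Plücker coordinate with the (unordered) index family `f`. -/
def plCoord (b : Basis (Fin (d + m)) ℂ V) (f : Fin d → Fin (d + m)) :
    Module.Dual ℂ (⋀[ℂ]^d V) :=
  exteriorPower.pairingDual ℂ V d (exteriorPower.ιMulti ℂ d (b.coord ∘ f))

/-- The matrix of the coordinates with indices `f` of a family of vectors. -/
def coordMatrix (b : Basis (Fin (d + m)) ℂ V) (f : Fin d → Fin (d + m)) (v : Fin d → V) :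
    Matrix (Fin d) (Fin d) ℂ :=
  Matrix.of fun i j => b.coord (f j) (v i)

theorem plCoord_ιMulti (b : Basis (Fin (d + m)) ℂ V) (f : Fin d → Fin (d + m)) (v : Fin d → V) :
    plCoord b f (exteriorPower.ιMulti ℂ d v) = (coordMatrix b f v).det := by
  rw [plCoord, exteriorPower.pairingDual_ιMulti_ιMulti]
  rfl

/-- The number of members of a family of indices that lie beyond the first `d`. -/
def highCount (f : Fin d → Fin (d + m)) : ℕ :=
  (Finset.univ.filter fun i => d ≤ (f i).val).card

theorem deg_eq_highCount (I : Set.powersetCard (Fin (d + m)) d) :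
    deg I = highCount (Set.powersetCard.ofFinEmbEquiv.symm I) := by
  rw [deg, highCount, ← Finset.card_map (Set.powersetCard.ofFinEmbEquiv.symm I).toEmbedding]
  congr 1
  ext i
  have := Set.powersetCard.mem_range_ofFinEmbEquiv_symm_iff_mem I i
  simp only [Finset.mem_filter, Finset.mem_map, Finset.mem_univ, true_and]
  constructor
  · rintro ⟨h1, h2⟩
    obtain ⟨t, rfl⟩ := this.2 h1
    exact ⟨t, h2, rfl⟩
  · rintro ⟨t, h2, rfl⟩
    exact ⟨this.1 ⟨t, rfl⟩, h2⟩

theorem highCount_le (f : Fin d → Fin (d + m)) : highCount f ≤ d := by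
  simpa [highCount] using Finset.card_filter_le (Finset.univ : Finset (Fin d)) fun i => d ≤ (f i).val

/-- The reason the charts survive truncation: a coordinate of degree less than `s` has all its
one-index neighbours in degree at most `s`. -/
theorem highCount_update_le (f : Fin d → Fin (d + m)) (i : Fin d) (j : Fin (d + m)) :
    highCount (Function.update f i j) ≤ highCount f + 1 := by
  rw [highCount, highCount]
  refine le_trans (Finset.card_le_card ?_) (Finset.card_insert_le i _)
  intro k hk
  by_cases h : k = i
  · simp [h]
  · simpa [h] using hk

/-- Pigeonhole: otherwise the high indices of `g` would inject into those of `f`. -/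
theorem exists_notMem_range_of_highCount_lt {f g : Fin d → Fin (d + m)}
    (hg : Function.Injective g) (h : highCount f < highCount g) : ∃ i, g i ∉ Set.range f := by
  by_contra! hcon
  choose t ht using hcon
  refine absurd h (not_lt.2 ?_)
  refine Finset.card_le_card_of_injOn t (fun i hi => ?_) fun i _ j _ hij => hg ?_
  · simpa [ht] using hi
  · rw [← ht i, hij, ht j]

theorem plCoord_eq_zero_of_mem_highDeg (b : Basis (Fin (d + m)) ℂ V) {s : ℕ}
    {f : Fin d → Fin (d + m)} (hf : highCount f ≤ s) {w : ⋀[ℂ]^d V} (hw : w ∈ highDeg b s) :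
    plCoord b f w = 0 := by
  induction hw using Submodule.span_induction with
  | mem w hw =>
    obtain ⟨I, hI, rfl⟩ := hw
    rw [deg_eq_highCount] at hI
    obtain ⟨i, hi⟩ := exists_notMem_range_of_highCount_lt
      (Set.powersetCard.ofFinEmbEquiv.symm I).injective (hf.trans_lt hI)
    rw [exteriorPower.basis_apply]
    exact pairing_eq_zero b _ _ i hi
  | zero => simp
  | add y z _ _ hy hz => rw [map_add, hy, hz, add_zero]
  | smul c y _ hy => rw [map_smul, hy, smul_zero]

/-- A vector all of whose Plücker coordinates of degree at most `s` vanish is zero in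
`(Λ^d V)_s`. -/
theorem mem_highDeg_of_plCoord_eq_zero (b : Basis (Fin (d + m)) ℂ V) {s : ℕ} {w : ⋀[ℂ]^d V}
    (hw : ∀ f : Fin d → Fin (d + m), Function.Injective f → highCount f ≤ s → plCoord b f w = 0) :
    w ∈ highDeg b s := by
  rw [← (b.exteriorPower d).sum_repr w]
  refine Submodule.sum_mem _ fun I _ => ?_
  by_cases hI : s < deg I
  · exact Submodule.smul_mem _ _ (Submodule.subset_span ⟨I, hI, rfl⟩)
  · have : (b.exteriorPower d).repr w I = 0 := by
      rw [exteriorPower.basis_repr_apply]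
      exact hw _ (Set.powersetCard.ofFinEmbEquiv.symm I).injective
        (by rw [← deg_eq_highCount]; exact not_lt.1 hI)
    rw [this, zero_smul]
    exact Submodule.zero_mem _

/-- No index set has degree above `d`, so truncating at `s = d` discards nothing. -/
theorem eq_of_plCoord_eq (b : Basis (Fin (d + m)) ℂ V) {w w' : ⋀[ℂ]^d V}
    (h : ∀ f, plCoord b f w = plCoord b f w') : w = w' := by
  rw [← sub_eq_zero]
  have h1 := mem_highDeg_of_plCoord_eq_zero b (s := d) (w := w - w') fun f _ _ => by
    rw [map_sub, h, sub_self]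
  have h2 : highDeg b d = ⊥ := by
    rw [highDeg, Submodule.span_eq_bot]
    rintro _ ⟨I, hI, -⟩
    rw [deg_eq_highCount] at hI
    exact absurd hI (not_lt.2 (highCount_le _))
  rwa [h2, Submodule.mem_bot] at h1

/-- The wedge product of linear combinations of `d` vectors. -/
theorem ιMulti_linearCombination (b : Basis (Fin (d + m)) ℂ V) (M : Matrix (Fin d) (Fin d) ℂ)
    (v : Fin d → V) :
    exteriorPower.ιMulti ℂ d (fun i => ∑ k, M i k • v k) =
      M.det • exteriorPower.ιMulti ℂ d v := by
  refine eq_of_plCoord_eq b fun f => ?_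
  rw [map_smul, plCoord_ιMulti, plCoord_ιMulti, smul_eq_mul, ← Matrix.det_mul]
  congr 1
  ext i j
  simp [coordMatrix, Matrix.mul_apply]

/-- The vectors that span the subspace with Plücker vector `q` in the chart where the coordinate
with index family `f` is nonzero. -/
def rowVec (b : Basis (Fin (d + m)) ℂ V) (f : Fin d → Fin (d + m)) (q : ⋀[ℂ]^d V) (i : Fin d) :
    V :=
  ∑ j, plCoord b (Function.update f i j) q • b j

theorem rowVec_smul (b : Basis (Fin (d + m)) ℂ V) (f : Fin d → Fin (d + m)) (c : ℂ)
    (q : ⋀[ℂ]^d V) : rowVec b f (c • q) = fun i => c • rowVec b f q i := by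
  funext i
  simp [rowVec, Finset.smul_sum, mul_smul]

/-- Cramer's rule: replacing the `i`-th index replaces the `i`-th column of the coordinate matrix,
and the resulting determinant is an entry of the adjugate applied to the new column. -/
theorem rowVec_ιMulti (b : Basis (Fin (d + m)) ℂ V) (f : Fin d → Fin (d + m)) (v : Fin d → V)
    (i : Fin d) : rowVec b f (exteriorPower.ιMulti ℂ d v) i =
      ∑ k, (coordMatrix b f v).adjugate i k • v k := by
  refine b.ext_elem fun j => ?_
  have h1 : coordMatrix b (Function.update f i j) v =
      (coordMatrix b f v).updateCol i fun k => b.coord j (v k) := by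
    ext k l
    by_cases h : l = i
    · subst h; simp [coordMatrix]
    · simp [coordMatrix, h]
  have h2 : plCoord b (Function.update f i j) (exteriorPower.ιMulti ℂ d v) =
      ∑ k, (coordMatrix b f v).adjugate i k * b.coord j (v k) := by
    rw [plCoord_ιMulti, h1, ← Matrix.cramer_apply, Matrix.cramer_eq_adjugate_mulVec]
    rfl
  have h3 : b.repr (rowVec b f (exteriorPower.ιMulti ℂ d v) i) j =
      plCoord b (Function.update f i j) (exteriorPower.ιMulti ℂ d v) := by
    simp [rowVec, Finsupp.single_apply]
  rw [h3, h2]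
  simp

theorem ιMulti_rowVec (b : Basis (Fin (d + m)) ℂ V) (f : Fin d → Fin (d + m)) (v : Fin d → V) :
    exteriorPower.ιMulti ℂ d (rowVec b f (exteriorPower.ιMulti ℂ d v)) =
      plCoord b f (exteriorPower.ιMulti ℂ d v) ^ (d - 1) • exteriorPower.ιMulti ℂ d v := by
  have : rowVec b f (exteriorPower.ιMulti ℂ d v) =
      fun i => ∑ k, (coordMatrix b f v).adjugate i k • v k :=
    funext fun i => rowVec_ιMulti b f v i
  rw [this, ιMulti_linearCombination b, Matrix.det_adjugate, plCoord_ιMulti, Fintype.card_fin]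

/-- The chart vectors span the subspace. -/
theorem span_rowVec (b : Basis (Fin (d + m)) ℂ V) (f : Fin d → Fin (d + m)) (v : Fin d → V)
    (h : plCoord b f (exteriorPower.ιMulti ℂ d v) ≠ 0) :
    Submodule.span ℂ (Set.range (rowVec b f (exteriorPower.ιMulti ℂ d v))) =
      Submodule.span ℂ (Set.range v) := by
  rw [plCoord_ιMulti] at h
  refine le_antisymm (Submodule.span_le.2 ?_) (Submodule.span_le.2 ?_)
  · rintro _ ⟨i, rfl⟩
    rw [rowVec_ιMulti]
    exact Submodule.sum_mem _ fun k _ =>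
      Submodule.smul_mem _ _ (Submodule.subset_span ⟨k, rfl⟩)
  · rintro _ ⟨i, rfl⟩
    have h1 : (coordMatrix b f v).det • v i = ∑ k, coordMatrix b f v i k •
        rowVec b f (exteriorPower.ιMulti ℂ d v) k := by
      simp only [rowVec_ιMulti, Finset.smul_sum, smul_smul]
      rw [Finset.sum_comm]
      simp only [← Finset.sum_smul]
      have h2 : ∀ l, ∑ k, coordMatrix b f v i k * (coordMatrix b f v).adjugate k l =
          (coordMatrix b f v).det * if i = l then 1 else 0 := by
        intro l
        have := congrFun (congrFun (Matrix.mul_adjugate (coordMatrix b f v)) i) l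
        rw [Matrix.mul_apply] at this
        rw [this]
        simp [Matrix.one_apply]
      simp [h2]
    have h3 : v i = (coordMatrix b f v).det⁻¹ • ∑ k, coordMatrix b f v i k •
        rowVec b f (exteriorPower.ιMulti ℂ d v) k := by
      rw [← h1, smul_smul, inv_mul_cancel₀ h, one_smul]
    rw [SetLike.mem_coe, h3]
    exact Submodule.smul_mem _ _ (Submodule.sum_mem _ fun k _ =>
      Submodule.smul_mem _ _ (Submodule.subset_span ⟨k, rfl⟩))

theorem mem_highSpace_iff (b : Basis (Fin (d + m)) ℂ V) (x : V) :
    x ∈ highSpace b ↔ ∀ j : Fin d, b.coord (Fin.castAdd m j) x = 0 := by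
  constructor
  · intro hx j
    induction hx using Submodule.span_induction with
    | mem x hx =>
      obtain ⟨i, rfl⟩ := hx
      have : Fin.castAdd m j ≠ Fin.natAdd d i := by
        intro h
        have := congrArg Fin.val h
        simp at this
        omega
      simp [Finsupp.single_eq_of_ne this]
    | zero => simp
    | add y z _ _ hy hz => rw [map_add, hy, hz, add_zero]
    | smul c y _ hy => rw [map_smul, hy, smul_zero]
  · intro h
    rw [← b.sum_repr x, Fin.sum_univ_add]
    refine Submodule.add_mem _ (Submodule.sum_mem _ fun j _ => ?_) (Submodule.sum_mem _ fun j _ => ?_)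
    · have := h j
      rw [Basis.coord_apply] at this
      rw [this, zero_smul]
      exact Submodule.zero_mem _
    · exact Submodule.smul_mem _ _ (Submodule.subset_span ⟨j, rfl⟩)

/-- A nonvanishing Plücker coordinate bounds the dimension of the intersection with
`V_{n-d}`. -/
theorem finrank_inf_highSpace_le (b : Basis (Fin (d + m)) ℂ V) (f : Fin d → Fin (d + m))
    (v : Fin d → V) (h : plCoord b f (exteriorPower.ιMulti ℂ d v) ≠ 0) :
    finrank ℂ (Submodule.span ℂ (Set.range v) ⊓ highSpace b : Submodule ℂ V) ≤ highCount f := by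
  have hV : Module.Finite ℂ V := Module.Finite.of_basis b
  rw [plCoord_ιMulti] at h
  -- An element of `U` is determined by its coordinates at `f`, the coordinate matrix being
  -- invertible; on `V_{n-d}` only those with index beyond the first `d` can be nonzero.
  let φ : (Submodule.span ℂ (Set.range v) ⊓ highSpace b : Submodule ℂ V) →ₗ[ℂ]
      ({i // d ≤ (f i).val} → ℂ) :=
    LinearMap.pi fun i => (b.coord (f i)).comp (Submodule.subtype _)
  have hφ : Function.Injective φ := by
    rw [injective_iff_map_eq_zero]
    rintro ⟨x, hx, hx'⟩ h0
    obtain ⟨c, rfl⟩ := (Submodule.mem_span_range_iff_exists_fun ℂ).1 hx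
    have h1 : ∀ j, b.coord (f j) (∑ i, c i • v i) = 0 := by
      intro j
      by_cases hj : d ≤ (f j).val
      · exact congrFun h0 ⟨j, hj⟩
      · have := (mem_highSpace_iff b _).1 hx' ⟨(f j).val, not_le.1 hj⟩
        exact this
    have h2 : Matrix.vecMul c (coordMatrix b f v) = 0 := by
      funext j
      have := h1 j
      rw [map_sum] at this
      simpa [Matrix.vecMul, dotProduct, coordMatrix] using this
    have h3 : c = 0 := by
      by_contra hc
      exact h (Matrix.exists_vecMul_eq_zero_iff.1 ⟨c, hc, h2⟩)
    apply Subtype.ext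
    simp [h3]
  have := LinearMap.finrank_le_finrank_of_injective hφ
  rw [Module.finrank_fintype_fun_eq_card, Fintype.card_subtype] at this
  exact this

/-- Some Plücker coordinate of degree at most `dim (U ∩ V_{n-d})` does not vanish. -/
theorem exists_plCoord_ne_zero (b : Basis (Fin (d + m)) ℂ V) (v : Fin d → V)
    (hv : LinearIndependent ℂ v) : ∃ f : Fin d → Fin (d + m),
      highCount f ≤ finrank ℂ (Submodule.span ℂ (Set.range v) ⊓ highSpace b : Submodule ℂ V) ∧
      plCoord b f (exteriorPower.ιMulti ℂ d v) ≠ 0 := by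
  classical
  have hV : Module.Finite ℂ V := Module.Finite.of_basis b
  set U := Submodule.span ℂ (Set.range v) with hU
  have hUd : finrank ℂ U = d := by
    rw [hU, finrank_span_eq_card hv, Fintype.card_fin]
  let c : Fin (d + m) → Module.Dual ℂ U := fun k => (b.coord k).comp U.subtype
  let T : Set (Fin (d + m)) := {k | k.val < d}
  -- Choose a basis of `U^*` among the restricted coordinate functionals greedily: `K₁` exhausts the
  -- span of the low ones, then `K` extends it by high ones.
  obtain ⟨K₁, hK₁T, -, hK₁s, hK₁⟩ := exists_linearIndepOn_extension (v := c)
    (linearIndepOn_empty ℂ c) (Set.empty_subset T)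
  obtain ⟨K, -, hK₁K, hKs, hK⟩ := exists_linearIndepOn_extension (v := c) hK₁
    (Set.subset_univ K₁)
  have hcard : ∀ K : Set (Fin (d + m)), LinearIndepOn ℂ c K →
      finrank ℂ (Submodule.span ℂ (c '' K)) = Fintype.card K := by
    intro K hK
    have := finrank_span_eq_card hK
    rwa [← Set.image_eq_range] at this
  have hann : ∀ (S K : Set (Fin (d + m))), c '' S ⊆ Submodule.span ℂ (c '' K) →
      ∀ x ∈ (Submodule.span ℂ (c '' K)).dualCoannihilator, ∀ k ∈ S, b.coord k x.1 = 0 := by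
    intro S K h x hx k hk
    exact (Submodule.mem_dualCoannihilator x).1 hx (c k) (h ⟨k, hk, rfl⟩)
  have hsum := fun W : Subspace ℂ (Module.Dual ℂ U) =>
    Subspace.finrank_add_finrank_dualCoannihilator_eq W
  have hKd : Fintype.card K = d := by
    have h1 : (Submodule.span ℂ (c '' K)).dualCoannihilator = ⊥ := by
      rw [Submodule.eq_bot_iff]
      intro x hx
      refine Subtype.ext (b.ext_elem fun k => ?_)
      simpa using hann _ _ hKs x hx k trivial
    have h2 := hsum (Submodule.span ℂ (c '' K))
    rw [hcard K hK, h1, finrank_bot, add_zero, hUd] at h2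
    exact h2
  -- The common kernel of the functionals in `K₁` lies in `U ∩ V_{n-d}`, so at most `dim (U ∩
  -- V_{n-d})` further functionals are needed.
  have hK₁d : d ≤ Fintype.card K₁ + finrank ℂ (U ⊓ highSpace b : Submodule ℂ V) := by
    have h2 := hsum (Submodule.span ℂ (c '' K₁))
    rw [hcard K₁ hK₁, hUd] at h2
    have h3 : (Submodule.span ℂ (c '' K₁)).dualCoannihilator.map U.subtype ≤ U ⊓ highSpace b := by
      rintro _ ⟨x, hx, rfl⟩
      exact ⟨x.2, (mem_highSpace_iff b _).2 fun j =>
        hann _ _ hK₁s x hx (Fin.castAdd m j) j.2⟩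
    have h4 := Submodule.finrank_mono h3
    rw [Submodule.finrank_map_subtype_eq] at h4
    omega
  let e : Fin d ≃ K := (finCongr hKd.symm).trans (Fintype.equivFin K).symm
  refine ⟨fun i => (e i).1, ?_, ?_⟩
  · have h1 : highCount (fun i => ((e i).1 : Fin (d + m))) ≤ (K.toFinset \ K₁.toFinset).card := by
      refine Finset.card_le_card_of_injOn (fun i => (e i).1) (fun i hi => ?_) fun i _ j _ hij =>
        e.injective (Subtype.ext hij)
      have hi' : d ≤ (e i).1.val := by simpa using hi
      have : (e i).1 ∉ K₁ := fun h => absurd (hK₁T h) (not_lt.2 hi')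
      simp [this]
    rw [Finset.card_sdiff_of_subset (Set.toFinset_subset_toFinset.2 hK₁K), Set.toFinset_card,
      Set.toFinset_card, hKd] at h1
    omega
  · rw [plCoord_ιMulti]
    intro hdet
    obtain ⟨y, hy, hy0⟩ := Matrix.exists_mulVec_eq_zero_iff.2 hdet
    apply hy
    -- A vector killed by the coordinate matrix is a linear relation between the chosen functionals,
    -- as the `v i` span `U`.
    have h1 : ∑ j, y j • c (e j).1 = 0 := by
      refine LinearMap.ext fun x => ?_
      obtain ⟨a, ha⟩ := (Submodule.mem_span_range_iff_exists_fun ℂ).1 x.2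
      have h2 : ∀ i, ∑ j, y j * b.coord (e j).1 (v i) = 0 := by
        intro i
        have := congrFun hy0 i
        simpa [Matrix.mulVec, dotProduct, coordMatrix, mul_comm] using this
      have h3 : ∑ j, y j * b.coord (e j).1 x.1 = 0 := by
        rw [← ha]
        simp only [map_sum, map_smul, smul_eq_mul, Finset.mul_sum]
        rw [Finset.sum_comm]
        refine Finset.sum_eq_zero fun i _ => ?_
        have h4 := congrArg (fun z => a i * z) (h2 i)
        simp only [Finset.mul_sum, mul_zero] at h4
        rw [← h4]
        exact Finset.sum_congr rfl fun j _ => by ring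
      simpa [c] using h3
    have h2 : LinearIndependent ℂ fun j => c (e j).1 := hK.comp e e.injective
    exact funext fun j => Fintype.linearIndependent_iff.1 h2 y h1 j

end PluckerCoordinates

/-! ### The open part and the inverse of the projection -/

section Embedding

variable {V : Type*} [AddCommGroup V] [Module ℂ V] {d m : ℕ}

theorem ιMulti_ne_zero (b : Basis (Fin (d + m)) ℂ V) {v : Fin d → V}
    (hv : LinearIndependent ℂ v) : exteriorPower.ιMulti ℂ d v ≠ 0 := by
  obtain ⟨f, -, hf⟩ := exists_plCoord_ne_zero b v hv
  intro h
  rw [h, map_zero] at hf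
  exact hf rfl

theorem linearIndependent_of_ιMulti_ne_zero {v : Fin d → V}
    (hv : exteriorPower.ιMulti ℂ d v ≠ 0) : LinearIndependent ℂ v := by
  by_contra h
  exact hv ((exteriorPower.ιMulti ℂ d).map_linearDependent v h)

/-- The span of a linearly independent family as a point of the Grassmannian. -/
def grSpan (v : Fin d → V) (hv : LinearIndependent ℂ v) : Gr V d :=
  ⟨Submodule.span ℂ (Set.range v), by rw [finrank_span_eq_card hv, Fintype.card_fin]⟩

theorem exists_eq_grSpan (b : Basis (Fin (d + m)) ℂ V) (U : Gr V d) :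
    ∃ (v : Fin d → V) (hv : LinearIndependent ℂ v), U = grSpan v hv := by
  have hV : Module.Finite ℂ V := Module.Finite.of_basis b
  let e := finBasisOfFinrankEq ℂ U.1 U.2
  have hli : LinearIndependent ℂ fun i => (e i : V) :=
    e.linearIndependent.map' U.1.subtype (Submodule.ker_subtype _)
  refine ⟨fun i => e i, hli, Subtype.ext ?_⟩
  have h1 : Set.range (fun i => (e i : V)) = U.1.subtype '' Set.range e := by
    rw [← Set.range_comp]; rfl
  change U.1 = Submodule.span ℂ (Set.range fun i => (e i : V))
  rw [h1, ← Submodule.map_span, e.span_eq, Submodule.map_subtype_top]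

theorem plucker_grSpan (b : Basis (Fin (d + m)) ℂ V) (v : Fin d → V)
    (hv : LinearIndependent ℂ v) :
    plucker b (grSpan v hv) = Projectivization.mk ℂ _ (ιMulti_ne_zero b hv) := by
  have hV : Module.Finite ℂ V := Module.Finite.of_basis b
  apply Projectivization.submodule_injective
  rw [plucker, Projectivization.submodule_mk'', Projectivization.submodule_mk]
  symm
  refine Submodule.eq_of_le_of_finrank_eq ?_ ?_
  · rw [Submodule.span_singleton_le_iff_mem]
    refine ⟨exteriorPower.ιMulti ℂ d fun i =>
      (⟨v i, Submodule.subset_span ⟨i, rfl⟩⟩ : (grSpan v hv).1), ?_⟩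
    rw [exteriorPower.map_apply_ιMulti]
    rfl
  · rw [finrank_range_wedge b, finrank_span_singleton (ιMulti_ne_zero b hv)]

theorem grSpan_mem_compl_schubert_iff (b : Basis (Fin (d + m)) ℂ V) (v : Fin d → V)
    (hv : LinearIndependent ℂ v) (s : ℕ) :
    grSpan v hv ∈ (schubert b s)ᶜ ↔ ∃ f : Fin d → Fin (d + m), highCount f < s ∧
      plCoord b f (exteriorPower.ιMulti ℂ d v) ≠ 0 := by
  change ¬ s ≤ finrank ℂ (Submodule.span ℂ (Set.range v) ⊓ highSpace b : Submodule ℂ V) ↔ _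
  rw [not_le]
  constructor
  · intro h
    obtain ⟨f, hf, hf'⟩ := exists_plCoord_ne_zero b v hv
    exact ⟨f, hf.trans_lt h, hf'⟩
  · rintro ⟨f, hf, hf'⟩
    exact (finrank_inf_highSpace_le b f v hf').trans_lt hf

theorem mem_openPart_iff (b : Basis (Fin (d + m)) ℂ V) (s : ℕ) (p : ℙ ℂ (⋀[ℂ]^d V)) :
    p ∈ openPart b s ↔ ∃ (v : Fin d → V) (hv : exteriorPower.ιMulti ℂ d v ≠ 0),
      p = Projectivization.mk ℂ _ hv ∧ ∃ f : Fin d → Fin (d + m), highCount f < s ∧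
        plCoord b f (exteriorPower.ιMulti ℂ d v) ≠ 0 := by
  constructor
  · rintro ⟨U, hU, rfl⟩
    obtain ⟨v, hv, rfl⟩ := exists_eq_grSpan b U
    exact ⟨v, ιMulti_ne_zero b hv, plucker_grSpan b v hv,
      (grSpan_mem_compl_schubert_iff b v hv s).1 hU⟩
  · rintro ⟨v, hv, rfl, h⟩
    have hv' := linearIndependent_of_ιMulti_ne_zero hv
    exact ⟨grSpan v hv', (grSpan_mem_compl_schubert_iff b v hv' s).2 h, plucker_grSpan b v hv'⟩

-- The subspace is recovered as the span of the chart vectors, which are merely rescaled when the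
-- Plücker vector is.
open scoped Pointwise in
theorem plucker_injective (b : Basis (Fin (d + m)) ℂ V) :
    Function.Injective (plucker (d := d) b) := by
  intro U U' h
  obtain ⟨v, hv, rfl⟩ := exists_eq_grSpan b U
  obtain ⟨v', hv', rfl⟩ := exists_eq_grSpan b U'
  rw [plucker_grSpan, plucker_grSpan, Projectivization.mk_eq_mk_iff'] at h
  obtain ⟨a, ha⟩ := h
  obtain ⟨f, -, hf⟩ := exists_plCoord_ne_zero b v hv
  have ha0 : a ≠ 0 := by
    rintro rfl
    rw [zero_smul] at ha
    exact ιMulti_ne_zero b hv ha.symm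
  have hf' : plCoord b f (exteriorPower.ιMulti ℂ d v') ≠ 0 := by
    rw [← ha, map_smul] at hf
    exact right_ne_zero_of_mul hf
  refine Subtype.ext ?_
  change Submodule.span ℂ (Set.range v) = Submodule.span ℂ (Set.range v')
  rw [← span_rowVec b f v hf, ← span_rowVec b f v' hf', ← ha, rowVec_smul]
  have h1 : Set.range (fun i => a • rowVec b f (exteriorPower.ιMulti ℂ d v') i) =
      a • Set.range (rowVec b f (exteriorPower.ιMulti ℂ d v')) := by
    ext x; simp [Set.mem_smul_set]
  rw [h1]
  exact Submodule.span_smul_eq_of_isUnit _ _ (isUnit_iff_ne_zero.2 ha0)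

theorem isOpenIn_openPart (b : Basis (Fin (d + m)) ℂ V) (s : ℕ) :
    IsOpenIn (openPart b s) (Set.range (plucker (d := d) b)) := by
  refine isOpenIn_of_forms {f : Fin d → Fin (d + m) | highCount f < s}
    (fun f _ => IsForm.dual (plCoord b f)) fun p => ⟨?_, ?_⟩
  · rintro ⟨U, hU, rfl⟩
    refine ⟨⟨U, rfl⟩, ?_⟩
    obtain ⟨v, hv, rfl⟩ := exists_eq_grSpan b U
    obtain ⟨f, hf, hf'⟩ := (grSpan_mem_compl_schubert_iff b v hv s).1 hU
    refine ⟨f, hf, ?_⟩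
    rwa [plucker_grSpan, Ne, (IsForm.dual (plCoord b f)).eq_zero_iff_rep]
  · rintro ⟨⟨U, rfl⟩, f, hf, hf'⟩
    refine ⟨U, ?_, rfl⟩
    obtain ⟨v, hv, rfl⟩ := exists_eq_grSpan b U
    rw [plucker_grSpan, Ne, (IsForm.dual (plCoord b f)).eq_zero_iff_rep] at hf'
    exact (grSpan_mem_compl_schubert_iff b v hv s).2 ⟨f, hf, hf'⟩

theorem truncMap_eq_zero_iff (b : Basis (Fin (d + m)) ℂ V) {s : ℕ} {w : ⋀[ℂ]^d V} :
    truncMap b s w = 0 ↔ w ∈ highDeg b s :=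
  Submodule.Quotient.mk_eq_zero _

/-- A linear section of the truncation map. -/
def truncSection (b : Basis (Fin (d + m)) ℂ V) (s : ℕ) : TruncWedge b s →ₗ[ℂ] ⋀[ℂ]^d V :=
  (LinearMap.exists_rightInverse_of_surjective (truncMap b s)
    (LinearMap.range_eq_top.2 (Submodule.mkQ_surjective _))).choose

theorem truncMap_truncSection (b : Basis (Fin (d + m)) ℂ V) (s : ℕ) (q : TruncWedge b s) :
    truncMap b s (truncSection b s q) = q :=
  LinearMap.congr_fun (LinearMap.exists_rightInverse_of_surjective (truncMap b s)
    (LinearMap.range_eq_top.2 (Submodule.mkQ_surjective _))).choose_spec q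

/-- The coordinate on `(Λ^d V)_s` induced by a Plücker coordinate of degree at most `s`. -/
def truncCoord (b : Basis (Fin (d + m)) ℂ V) (s : ℕ) (f : Fin d → Fin (d + m)) :
    Module.Dual ℂ (TruncWedge b s) :=
  (plCoord b f).comp (truncSection b s)

/-- The chosen section is irrelevant here: two lifts differ by an element of `highDeg`, on which
coordinates of degree at most `s` vanish. -/
theorem truncCoord_truncMap (b : Basis (Fin (d + m)) ℂ V) {s : ℕ} {f : Fin d → Fin (d + m)}
    (hf : highCount f ≤ s) (w : ⋀[ℂ]^d V) : truncCoord b s f (truncMap b s w) = plCoord b f w := by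
  rw [← sub_eq_zero, truncCoord, LinearMap.comp_apply, ← map_sub]
  refine plCoord_eq_zero_of_mem_highDeg b hf ?_
  rw [← truncMap_eq_zero_iff, map_sub]
  exact sub_eq_zero.2 (truncMap_truncSection b s _)

theorem trunc_ext (b : Basis (Fin (d + m)) ℂ V) {s : ℕ} {q q' : TruncWedge b s}
    (h : ∀ f : Fin d → Fin (d + m), Function.Injective f → highCount f ≤ s →
      truncCoord b s f q = truncCoord b s f q') : q = q' := by
  rw [← truncMap_truncSection b s q, ← truncMap_truncSection b s q', ← sub_eq_zero, ← map_sub,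
    truncMap_eq_zero_iff]
  refine mem_highDeg_of_plCoord_eq_zero b fun f hf hfs => ?_
  rw [map_sub]
  exact sub_eq_zero.2 (h f hf hfs)

/-- The decomposable vector reconstructed from the truncated Plücker coordinates in the chart
`f`. -/
def chartVec (b : Basis (Fin (d + m)) ℂ V) (s : ℕ) (f : Fin d → Fin (d + m))
    (q : TruncWedge b s) : ⋀[ℂ]^d V :=
  exteriorPower.ιMulti ℂ d (rowVec b f (truncSection b s q))

theorem chartVec_smul (b : Basis (Fin (d + m)) ℂ V) (s : ℕ) (f : Fin d → Fin (d + m)) (c : ℂ)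
    (q : TruncWedge b s) : chartVec b s f (c • q) = c ^ d • chartVec b s f q := by
  rw [chartVec, map_smul, rowVec_smul, AlternatingMap.map_smul_univ]
  simp [chartVec]

/-- The strict inequality is essential: `rowVec` uses coordinates of degree up to `highCount f + 1`,
which must not exceed `s`. -/
theorem chartVec_truncMap (b : Basis (Fin (d + m)) ℂ V) {s : ℕ} {f : Fin d → Fin (d + m)}
    (hf : highCount f < s) (v : Fin d → V) :
    chartVec b s f (truncMap b s (exteriorPower.ιMulti ℂ d v)) =
      plCoord b f (exteriorPower.ιMulti ℂ d v) ^ (d - 1) • exteriorPower.ιMulti ℂ d v := by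
  rw [← ιMulti_rowVec, chartVec]
  congr 1
  funext i
  refine Finset.sum_congr rfl fun j _ => ?_
  congr 1
  exact truncCoord_truncMap b ((highCount_update_le f i j).trans hf) _

/-- Expanding the wedge product multilinearly leaves products of `d` truncated coordinates with
constant coefficients. -/
theorem isHomogPolyMap_chartVec (b : Basis (Fin (d + m)) ℂ V) (s : ℕ)
    (f : Fin d → Fin (d + m)) : IsHomogPolyMap d (chartVec b s f) := by
  intro l
  have h : ∀ q, l (chartVec b s f q) = ∑ g : Fin d → Fin (d + m),
      (∏ i, truncCoord b s (Function.update f i (g i)) q) *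
        l (exteriorPower.ιMulti ℂ d fun i => b (g i)) := by
    intro q
    have h1 : rowVec b f (truncSection b s q) =
      fun i => ∑ j, truncCoord b s (Function.update f i j) q • b j := rfl
    rw [chartVec, h1, ← AlternatingMap.coe_multilinearMap, MultilinearMap.map_sum, map_sum]
    refine Finset.sum_congr rfl fun g _ => ?_
    rw [MultilinearMap.map_smul_univ, map_smul]
    rfl
  simp only [h]
  refine IsForm.sum _ fun g => IsForm.mul_const ?_ _
  have := IsForm.prod_dual Finset.univ fun i => truncCoord b s (Function.update f i (g i))
  simpa using this

theorem openPart_subset_projDomain (b : Basis (Fin (d + m)) ℂ V) (s : ℕ) :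
    openPart b s ⊆ projDomain (truncMap b s) := by
  intro p hp
  obtain ⟨v, hv, rfl, f, hf, hf'⟩ := (mem_openPart_iff b s p).1 hp
  obtain ⟨a, ha⟩ := Projectivization.exists_smul_eq_mk_rep ℂ _ hv
  change truncMap b s _ ≠ 0
  rw [← ha, Units.smul_def, map_smul]
  refine smul_ne_zero a.ne_zero fun h0 => hf' ?_
  rw [← truncCoord_truncMap b hf.le, h0, map_zero]

/-- A homogeneous polynomial map inverting the projection in the chart `f`. -/
def chartInv (b : Basis (Fin (d + m)) ℂ V) (s : ℕ) (f : Fin d → Fin (d + m))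
    (q : TruncWedge b s) : ⋀[ℂ]^d V :=
  truncCoord b s f q • chartVec b s f q

theorem isHomogPolyMap_chartInv (b : Basis (Fin (d + m)) ℂ V) (s : ℕ)
    (f : Fin d → Fin (d + m)) : IsHomogPolyMap (1 + d) (chartInv b s f) := by
  intro l
  have h1 : IsForm d fun q => l (chartVec b s f q) := isHomogPolyMap_chartVec b s f l
  have := (IsForm.dual (truncCoord b s f)).mul h1
  simpa only [chartInv, map_smul, smul_eq_mul] using! this

/-- The inverse formula on the image of the open part. -/
theorem exists_chartInv_eq (b : Basis (Fin (d + m)) ℂ V) (s : ℕ)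
    (h : openPart b s ⊆ projDomain (truncMap b s)) (x : openPart b s)
    {f : Fin d → Fin (d + m)} (hf : highCount f < s) :
    ∃ c : ℂ, chartInv b s f (truncProj b s h x).rep = c • x.1.rep ∧
      (c ≠ 0 ↔ plCoord b f x.1.rep ≠ 0) := by
  obtain ⟨p, hp⟩ := x
  obtain ⟨v, hv, rfl, -⟩ := (mem_openPart_iff b s p).1 hp
  obtain ⟨a, ha⟩ := Projectivization.exists_smul_eq_mk_rep ℂ _ hv
  obtain ⟨a', ha'⟩ := Projectivization.exists_smul_eq_mk_rep ℂ
    (truncMap b s (Projectivization.mk ℂ _ hv).rep) (h hp)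
  have h1 : (truncProj b s h ⟨_, hp⟩).rep =
      ((a' : ℂ) * a) • truncMap b s (exteriorPower.ιMulti ℂ d v) := by
    change (Projectivization.mk ℂ (truncMap b s (Projectivization.mk ℂ _ hv).rep) (h hp)).rep = _
    rw [← ha', ← ha, mul_smul, Units.smul_def, Units.smul_def, map_smul]
  have ha0 := a.ne_zero
  have ha0' := a'.ne_zero
  set P := plCoord b f (exteriorPower.ιMulti ℂ d v) with hP
  -- The factors come from the coordinate in `chartInv`, from `chartVec` (of degree `d`, with `P ^
  -- (d - 1)` from the adjugate), and from passing back to the representative. The extra `P` makes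
  -- the nonvanishing locus exact also for `d = 1`, where `P ^ (d - 1) = 1`.
  refine ⟨((a' : ℂ) * a * P) * ((a' * a) ^ d * P ^ (d - 1)) * (a : ℂ)⁻¹, ?_, ?_⟩
  · rw [h1, chartInv, chartVec_smul, chartVec_truncMap b hf, map_smul,
      truncCoord_truncMap b hf.le, ← ha, Units.smul_def]
    simp only [smul_smul, smul_eq_mul]
    congr 1
    rw [← hP]
    field_simp
  · change _ ↔ plCoord b f (Projectivization.mk ℂ _ hv).rep ≠ 0
    rw [← ha, Units.smul_def, map_smul, smul_eq_mul, ← hP]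
    by_cases hP0 : P = 0
    · simp [hP0]
    · simp [hP0, ha0, ha0']

theorem exists_plCoord_rep_ne_zero (b : Basis (Fin (d + m)) ℂ V) (s : ℕ) (x : openPart b s) :
    ∃ f : Fin d → Fin (d + m), highCount f < s ∧ plCoord b f x.1.rep ≠ 0 := by
  obtain ⟨p, hp⟩ := x
  obtain ⟨v, hv, rfl, f, hf, hf'⟩ := (mem_openPart_iff b s p).1 hp
  exact ⟨f, hf, fun h0 => hf' (((IsForm.dual (plCoord b f)).eq_zero_iff_rep hv).1 h0)⟩

theorem eq_mk_of_eq_smul {W : Type*} [AddCommGroup W] [Module ℂ W] {p : ℙ ℂ W} {w : W} {c : ℂ}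
    (hw : w ≠ 0) (h : w = c • p.rep) : p = Projectivization.mk ℂ w hw := by
  conv_lhs => rw [← p.mk_rep]
  rw [Projectivization.mk_eq_mk_iff']
  have hc : c ≠ 0 := by rintro rfl; exact hw (by rw [h, zero_smul])
  exact ⟨c⁻¹, by rw [h, smul_smul, inv_mul_cancel₀ hc, one_smul]⟩

theorem truncProj_injective (b : Basis (Fin (d + m)) ℂ V) (s : ℕ)
    (h : openPart b s ⊆ projDomain (truncMap b s)) : Function.Injective (truncProj b s h) := by
  intro x y hxy
  obtain ⟨f, hf, hf'⟩ := exists_plCoord_rep_ne_zero b s x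
  obtain ⟨c, hc, hc0⟩ := exists_chartInv_eq b s h x hf
  obtain ⟨c', hc', -⟩ := exists_chartInv_eq b s h y hf
  have hne : chartInv b s f (truncProj b s h x).rep ≠ 0 := by
    rw [hc]
    exact smul_ne_zero (hc0.2 hf') x.1.rep_nonzero
  refine Subtype.ext ((eq_mk_of_eq_smul hne hc).trans (eq_mk_of_eq_smul (c := c') hne ?_).symm)
  rw [hxy, hc']

/-- The inverse is chosen pointwise as a preimage, unambiguous by injectivity; near each point it
coincides with some `chartInv`, which proves regularity. -/
theorem isRegularEmbedding_truncProj (b : Basis (Fin (d + m)) ℂ V) (s : ℕ)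
    (h : openPart b s ⊆ projDomain (truncMap b s)) : IsRegularEmbedding (truncProj b s h) := by
  refine ⟨fun x => ⟨1, truncMap b s, isHomogPolyMap_linear _, h x.2, fun y hy => rfl⟩,
    fun y => y.2.choose.1, ?_, fun x => ?_⟩
  · rintro ⟨_, x, rfl⟩
    obtain ⟨f, hf, hf'⟩ := exists_plCoord_rep_ne_zero b s x
    refine ⟨1 + d, chartInv b s f, isHomogPolyMap_chartInv b s f, ?_, ?_⟩
    · obtain ⟨c, hc, hc0⟩ := exists_chartInv_eq b s h x hf
      rw [hc]
      exact smul_ne_zero (hc0.2 hf') x.1.rep_nonzero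
    · intro y hy
      obtain ⟨c, hc, -⟩ := exists_chartInv_eq b s h y.2.choose hf
      rw [y.2.choose_spec] at hc
      exact eq_mk_of_eq_smul hy hc
  · have := truncProj_injective b s h (Set.mem_range_self (f := truncProj b s h) x).choose_spec
    exact congrArg Subtype.val this

end Embedding

/-! ### The orbit as graphs, its closure, and the image of the open part -/

section Orbit

variable {V : Type*} [AddCommGroup V] [Module ℂ V] {d m : ℕ}

/-- The basis of the graph of the linear map `V_d → V_{n-d}` with matrix `M`. -/
def graphFam (b : Basis (Fin (d + m)) ℂ V) (M : Matrix (Fin m) (Fin d) ℂ) (j : Fin d) : V :=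
  b (Fin.castAdd m j) + ∑ i, M i j • b (Fin.natAdd d i)

theorem natAdd_ne_castAdd (i : Fin m) (j : Fin d) : Fin.natAdd d i ≠ Fin.castAdd m j := by
  intro h
  have := congrArg Fin.val h
  simp at this
  omega

theorem coord_castAdd_graphFam (b : Basis (Fin (d + m)) ℂ V) (M : Matrix (Fin m) (Fin d) ℂ)
    (j k : Fin d) : b.coord (Fin.castAdd m k) (graphFam b M j) = if j = k then 1 else 0 := by
  simp [graphFam, Finsupp.single_apply, natAdd_ne_castAdd, (Fin.castAdd_injective d m).eq_iff]

theorem coord_natAdd_graphFam (b : Basis (Fin (d + m)) ℂ V) (M : Matrix (Fin m) (Fin d) ℂ)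
    (j : Fin d) (l : Fin m) : b.coord (Fin.natAdd d l) (graphFam b M j) = M l j := by
  simp [graphFam, Finsupp.single_apply, (natAdd_ne_castAdd _ _).symm,
    (Fin.natAdd_injective m d).eq_iff]

theorem plCoord_castAdd_graphFam (b : Basis (Fin (d + m)) ℂ V) (M : Matrix (Fin m) (Fin d) ℂ) :
    plCoord b (Fin.castAdd m) (exteriorPower.ιMulti ℂ d (graphFam b M)) = 1 := by
  rw [plCoord_ιMulti, ← Matrix.det_one (n := Fin d)]
  congr 1
  ext i j
  simp only [coordMatrix, Matrix.of_apply, coord_castAdd_graphFam, Matrix.one_apply]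

theorem highCount_castAdd : highCount (Fin.castAdd m : Fin d → Fin (d + m)) = 0 := by
  simp [highCount]

theorem truncMap_graphFam_ne_zero (b : Basis (Fin (d + m)) ℂ V) (s : ℕ)
    (M : Matrix (Fin m) (Fin d) ℂ) :
    truncMap b s (exteriorPower.ιMulti ℂ d (graphFam b M)) ≠ 0 := by
  intro h
  have h1 := plCoord_castAdd_graphFam b M
  rw [← truncCoord_truncMap b (s := s) (by rw [highCount_castAdd]; exact Nat.zero_le s), h,
    map_zero] at h1
  exact zero_ne_one h1

theorem map_topVector (b : Basis (Fin (d + m)) ℂ V) (M : Fin m × Fin d → ℂ) :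
    exteriorPower.map d (1 + ∑ ij : Fin m × Fin d, M ij •
      (b.coord (Fin.castAdd m ij.2)).smulRight (b (Fin.natAdd d ij.1))) (topVector b) =
    exteriorPower.ιMulti ℂ d (graphFam b (Matrix.of fun i j => M (i, j))) := by
  rw [topVector, exteriorPower.map_apply_ιMulti]
  congr 1
  funext j
  simp only [Function.comp_apply, LinearMap.add_apply, Module.End.one_apply, graphFam,
    LinearMap.sum_apply, LinearMap.smul_apply, LinearMap.smulRight_apply, Matrix.of_apply]
  congr 1
  rw [Fintype.sum_prod_type]
  refine Finset.sum_congr rfl fun i _ => ?_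
  rw [Finset.sum_eq_single j]
  · simp
  · intro k _ hk
    have : Fin.castAdd m k ≠ Fin.castAdd m j := fun h => hk (Fin.castAdd_injective d m h)
    simp [Finsupp.single_eq_of_ne this]
  · simp

theorem mem_truncOrbit_iff (b : Basis (Fin (d + m)) ℂ V) (s : ℕ) (p : ℙ ℂ (TruncWedge b s)) :
    p ∈ truncOrbit b s ↔ ∃ M, p = Projectivization.mk ℂ _ (truncMap_graphFam_ne_zero b s M) := by
  constructor
  · rintro ⟨_, ⟨a, ha, rfl⟩, h, rfl⟩
    obtain ⟨M, rfl⟩ := (Submodule.mem_span_range_iff_exists_fun ℂ).1 ha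
    refine ⟨Matrix.of fun i j => M (i, j), ?_⟩
    congr 2
    exact map_topVector b M
  · rintro ⟨M, rfl⟩
    have h1 := map_topVector b fun ij : Fin m × Fin d => M ij.1 ij.2
    refine ⟨_, ⟨_, (Submodule.mem_span_range_iff_exists_fun ℂ).2 ⟨fun ij => M ij.1 ij.2, rfl⟩,
      rfl⟩, ?_, ?_⟩
    · rw [h1]
      exact truncMap_graphFam_ne_zero b s M
    · congr 2
      exact h1.symm

/-- Working form of the closure: forms are tested on the explicit vectors of graphs instead of
representatives of points. -/
theorem mem_truncGr_iff (b : Basis (Fin (d + m)) ℂ V) (s : ℕ) (p : ℙ ℂ (TruncWedge b s)) :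
    p ∈ truncGr b s ↔ ∀ (k : ℕ) (g : TruncWedge b s → ℂ), IsForm k g →
      (∀ M, g (truncMap b s (exteriorPower.ιMulti ℂ d (graphFam b M))) = 0) → g p.rep = 0 := by
  rw [truncGr, mem_closure_zariski_iff]
  refine forall₃_congr fun k g hg => imp_congr_left ?_
  constructor
  · intro h M
    exact (hg.eq_zero_iff_rep (truncMap_graphFam_ne_zero b s M)).1
      (h _ ((mem_truncOrbit_iff b s _).2 ⟨M, rfl⟩))
  · intro h a ha
    obtain ⟨M, rfl⟩ := (mem_truncOrbit_iff b s a).1 ha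
    exact (hg.eq_zero_iff_rep _).2 (h M)

theorem plCoord_eq_zero_of_not_injective (b : Basis (Fin (d + m)) ℂ V)
    {f : Fin d → Fin (d + m)} (hf : ¬ Function.Injective f) : plCoord b f = 0 := by
  rw [plCoord, AlternatingMap.map_eq_zero_of_not_injective, map_zero]
  exact fun h => hf h.of_comp

/-- A decomposable vector in the big cell is a multiple of the vector of a graph. -/
theorem exists_eq_smul_graphFam (b : Basis (Fin (d + m)) ℂ V) (hd : 1 ≤ d) (v : Fin d → V)
    (h : plCoord b (Fin.castAdd m) (exteriorPower.ιMulti ℂ d v) ≠ 0) :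
    ∃ (c : ℂ) (M : Matrix (Fin m) (Fin d) ℂ), exteriorPower.ιMulti ℂ d v =
      c • exteriorPower.ιMulti ℂ d (graphFam b M) := by
  set q := exteriorPower.ιMulti ℂ d v with hq
  set P := plCoord b (Fin.castAdd m) q with hP
  -- The affine coordinates of the big cell: replacing one low index by a high one and dividing by
  -- `P` gives the entry of `M`. Replacing it by another low index repeats an index and gives zero.
  let M : Matrix (Fin m) (Fin d) ℂ := Matrix.of fun i j =>
    P⁻¹ * plCoord b (Function.update (Fin.castAdd m) j (Fin.natAdd d i)) q
  have h1 : rowVec b (Fin.castAdd m) q = fun j => P • graphFam b M j := by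
    funext j
    rw [rowVec, Fin.sum_univ_add, graphFam, smul_add, Finset.smul_sum]
    congr 1
    · rw [Finset.sum_eq_single j]
      · rw [Function.update_eq_self]
      · intro k _ hk
        rw [plCoord_eq_zero_of_not_injective, LinearMap.zero_apply, zero_smul]
        intro hinj
        exact hk (hinj (by simp [hk]))
      · simp
    · refine Finset.sum_congr rfl fun i _ => ?_
      simp only [M, Matrix.of_apply, smul_smul]
      rw [mul_inv_cancel_left₀ h]
  have h2 := ιMulti_rowVec b (Fin.castAdd m) v
  rw [← hq, h1, AlternatingMap.map_smul_univ, ← hP] at h2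
  refine ⟨P, M, ?_⟩
  have h3 : (∏ _i : Fin d, P) = P ^ (d - 1) * P := by
    rw [Finset.prod_const, Finset.card_univ, Fintype.card_fin, ← pow_succ, Nat.sub_add_cancel hd]
  rw [h3, mul_smul] at h2
  exact (smul_right_injective _ (pow_ne_zero (d - 1) h) h2).symm

/-- A linear function of the wedge product of a moving family is a polynomial in the parameter. -/
theorem exists_polynomial_ιMulti_add_smul (l : Module.Dual ℂ (⋀[ℂ]^d V)) (v e : Fin d → V) :
    ∃ p : Polynomial ℂ, ∀ t : ℂ, l (exteriorPower.ιMulti ℂ d fun i => v i + t • e i) =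
      p.eval t := by
  refine ⟨∑ S : Finset (Fin d), Polynomial.C (l (exteriorPower.ιMulti ℂ d (S.piecewise e v))) *
    Polynomial.X ^ S.card, fun t => ?_⟩
  have h1 : (fun i => v i + t • e i) = (fun i => t • e i) + v := by
    funext i; simp [add_comm]
  rw [h1, ← AlternatingMap.coe_multilinearMap, MultilinearMap.map_add_univ, map_sum,
    Polynomial.eval_finsetSum]
  refine Finset.sum_congr rfl fun S _ => ?_
  have h2 : S.piecewise (fun i => t • e i) v =
      S.piecewise (fun i => (fun _ : Fin d => t) i • S.piecewise e v i) (S.piecewise e v) := by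
    funext i
    by_cases h : i ∈ S <;> simp [h]
  rw [h2, MultilinearMap.map_piecewise_smul, map_smul, Finset.prod_const, smul_eq_mul,
    Polynomial.eval_mul, Polynomial.eval_C, Polynomial.eval_pow, Polynomial.eval_X, mul_comm]

/-- A form vanishing on the orbit vanishes on all decomposable vectors. -/
theorem form_eq_zero_of_graphFam (b : Basis (Fin (d + m)) ℂ V) (hd : 1 ≤ d) (s : ℕ) {k : ℕ}
    {g : TruncWedge b s → ℂ} (hg : IsForm k g)
    (h : ∀ M, g (truncMap b s (exteriorPower.ιMulti ℂ d (graphFam b M))) = 0) (v : Fin d → V) :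
    g (truncMap b s (exteriorPower.ιMulti ℂ d v)) = 0 := by
  -- Density of the big cell along the curve `v + t e`: its leading coordinate `det (A + t)` is a
  -- characteristic polynomial in `t`, hence monic. Where it is nonzero the form vanishes, so the
  -- product of the two polynomials is zero; then `t = 0` gives the claim.
  let e : Fin d → V := fun i => b (Fin.castAdd m i)
  obtain ⟨p, hp⟩ := hg.exists_polynomial
    (w := fun t => truncMap b s (exteriorPower.ιMulti ℂ d fun i => v i + t • e i)) fun l =>
      exists_polynomial_ιMulti_add_smul (l.comp (truncMap b s)) v e
  let A := coordMatrix b (Fin.castAdd m) v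
  have h1 : ∀ t, plCoord b (Fin.castAdd m) (exteriorPower.ιMulti ℂ d fun i => v i + t • e i) =
      (-A).charpoly.eval t := by
    intro t
    rw [plCoord_ιMulti, Matrix.eval_charpoly]
    congr 1
    ext i j
    simp [A, e, coordMatrix, Matrix.scalar_apply, Matrix.diagonal_apply, Finsupp.single_apply,
      (Fin.castAdd_injective d m).eq_iff, add_comm]
  have h2 : p * (-A).charpoly = 0 := by
    refine Polynomial.funext fun t => ?_
    rw [Polynomial.eval_mul, Polynomial.eval_zero, ← h1, ← hp]
    by_cases h0 : plCoord b (Fin.castAdd m)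
        (exteriorPower.ιMulti ℂ d fun i => v i + t • e i) = 0
    · rw [h0, mul_zero]
    · obtain ⟨c, M, hc⟩ := exists_eq_smul_graphFam b hd _ h0
      rw [hc, map_smul, hg.smul, h, mul_zero, zero_mul]
  have h3 : p = 0 := (mul_eq_zero.1 h2).resolve_right (Matrix.charpoly_monic _).ne_zero
  have h4 := hp 0
  rw [h3] at h4
  simpa using h4

theorem mem_range_truncProj_iff (b : Basis (Fin (d + m)) ℂ V) (s : ℕ)
    (h : openPart b s ⊆ projDomain (truncMap b s)) (p : ℙ ℂ (TruncWedge b s)) :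
    p ∈ Set.range (truncProj b s h) ↔ ∃ (v : Fin d → V)
      (hv : truncMap b s (exteriorPower.ιMulti ℂ d v) ≠ 0),
      p = Projectivization.mk ℂ _ hv ∧ ∃ f : Fin d → Fin (d + m), highCount f < s ∧
        plCoord b f (exteriorPower.ιMulti ℂ d v) ≠ 0 := by
  have key : ∀ (v : Fin d → V) (hv : exteriorPower.ιMulti ℂ d v ≠ 0)
      (hp : Projectivization.mk ℂ _ hv ∈ openPart b s)
      (hv' : truncMap b s (exteriorPower.ιMulti ℂ d v) ≠ 0),
      truncProj b s h ⟨_, hp⟩ = Projectivization.mk ℂ _ hv' := by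
    intro v hv hp hv'
    obtain ⟨a, ha⟩ := Projectivization.exists_smul_eq_mk_rep ℂ _ hv
    exact (Projectivization.mk_eq_mk_iff' ℂ _ _ (h hp) hv').2 ⟨a, by rw [← map_smul, ← ha]; rfl⟩
  have hne : ∀ (v : Fin d → V) (f : Fin d → Fin (d + m)), highCount f < s →
      plCoord b f (exteriorPower.ιMulti ℂ d v) ≠ 0 →
      truncMap b s (exteriorPower.ιMulti ℂ d v) ≠ 0 := by
    intro v f hf hf' h0
    rw [← truncCoord_truncMap b hf.le, h0, map_zero] at hf'
    exact hf' rfl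
  constructor
  · rintro ⟨⟨_, hp⟩, rfl⟩
    obtain ⟨v, hv, rfl, f, hf, hf'⟩ := (mem_openPart_iff b s _).1 hp
    exact ⟨v, hne v f hf hf', key v hv hp _, f, hf, hf'⟩
  · rintro ⟨v, hv, rfl, f, hf, hf'⟩
    have hv' : exteriorPower.ιMulti ℂ d v ≠ 0 := fun h0 => hv (by rw [h0, map_zero])
    exact ⟨⟨_, (mem_openPart_iff b s _).2 ⟨v, hv', rfl, f, hf, hf'⟩⟩, key v hv' _ hv⟩

theorem range_truncProj_subset_truncGr (b : Basis (Fin (d + m)) ℂ V) (hd : 1 ≤ d) (s : ℕ)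
    (h : openPart b s ⊆ projDomain (truncMap b s)) :
    Set.range (truncProj b s h) ⊆ truncGr b s := by
  intro p hp
  obtain ⟨v, hv, rfl, -⟩ := (mem_range_truncProj_iff b s h p).1 hp
  rw [mem_truncGr_iff]
  intro k g hg h0
  exact (hg.eq_zero_iff_rep hv).2 (form_eq_zero_of_graphFam b hd s hg h0 v)

/-- On the truncated Grassmannian a point is reconstructed from its chart vector. -/
theorem truncMap_chartVec_of_mem_truncGr (b : Basis (Fin (d + m)) ℂ V) (hd : 1 ≤ d) {s : ℕ}
    {f : Fin d → Fin (d + m)} (hf : highCount f < s) {p : ℙ ℂ (TruncWedge b s)}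
    (hp : p ∈ truncGr b s) :
    truncMap b s (chartVec b s f p.rep) = truncCoord b s f p.rep ^ (d - 1) • p.rep := by
  refine trunc_ext b fun f' _ _ => ?_
  have h1 : IsForm d fun q => truncCoord b s f' (truncMap b s (chartVec b s f q)) :=
    isHomogPolyMap_chartVec b s f ((truncCoord b s f').comp (truncMap b s))
  have h2 : IsForm d fun q => truncCoord b s f q ^ (d - 1) * truncCoord b s f' q := by
    have := ((IsForm.dual (truncCoord b s f)).pow (d - 1)).mul (IsForm.dual (truncCoord b s f'))
    rwa [one_mul, Nat.sub_add_cancel hd] at this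
  -- Coordinatewise, the reconstruction formula is an equality of two forms of degree `d`; holding
  -- on the orbit, it holds on the closure.
  have h3 := (mem_truncGr_iff b s p).1 hp d _ (h1.sub h2) fun M => by
    rw [chartVec_truncMap b hf, map_smul, map_smul, truncCoord_truncMap b hf.le, smul_eq_mul,
      sub_self]
  rw [map_smul, smul_eq_mul]
  exact sub_eq_zero.1 h3

/-- The reconstruction formula exhibits a point of the closure with a nonzero coordinate of degree
less than `s` as the class of a decomposable vector, so the closure adds no new points there. -/
theorem mem_range_truncProj_iff_mem_truncGr (b : Basis (Fin (d + m)) ℂ V) (hd : 1 ≤ d) (s : ℕ)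
    (h : openPart b s ⊆ projDomain (truncMap b s)) (p : ℙ ℂ (TruncWedge b s)) :
    p ∈ Set.range (truncProj b s h) ↔ p ∈ truncGr b s ∧
      ∃ f ∈ {f : Fin d → Fin (d + m) | highCount f < s}, truncCoord b s f p.rep ≠ 0 := by
  constructor
  · intro hp
    refine ⟨range_truncProj_subset_truncGr b hd s h hp, ?_⟩
    obtain ⟨v, hv, rfl, f, hf, hf'⟩ := (mem_range_truncProj_iff b s h p).1 hp
    refine ⟨f, hf, fun h0 => hf' ?_⟩
    rw [← truncCoord_truncMap b (le_of_lt hf)]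
    exact ((IsForm.dual (truncCoord b s f)).eq_zero_iff_rep hv).1 h0
  · rintro ⟨hp, f, hf, hf'⟩
    have h1 := truncMap_chartVec_of_mem_truncGr b hd hf hp
    have hne : truncMap b s (chartVec b s f p.rep) ≠ 0 := by
      rw [h1]
      exact smul_ne_zero (pow_ne_zero _ hf') p.rep_nonzero
    refine (mem_range_truncProj_iff b s h p).2 ⟨rowVec b f (truncSection b s p.rep), hne,
      eq_mk_of_eq_smul hne h1, f, hf, ?_⟩
    change plCoord b f (chartVec b s f p.rep) ≠ 0
    rw [← truncCoord_truncMap b (le_of_lt hf), h1, map_smul]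
    exact smul_ne_zero (pow_ne_zero _ hf') hf'

theorem isOpenIn_range_truncProj (b : Basis (Fin (d + m)) ℂ V) (hd : 1 ≤ d) (s : ℕ)
    (h : openPart b s ⊆ projDomain (truncMap b s)) :
    IsOpenIn (Set.range (truncProj b s h)) (truncGr b s) :=
  isOpenIn_of_forms _ (fun f _ => IsForm.dual (truncCoord b s f))
    (mem_range_truncProj_iff_mem_truncGr b hd s h)

end Orbit

/-! ### The degree `s` part of the closure and the relations between minors -/

section Boundary

variable {V : Type*} [AddCommGroup V] [Module ℂ V] {d m : ℕ}

theorem coord_graphFam_smul (b : Basis (Fin (d + m)) ℂ V) (M : Matrix (Fin m) (Fin d) ℂ) (t : ℂ)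
    (i : Fin d) (k : Fin (d + m)) : b.coord k (graphFam b (t • M) i) =
      (if d ≤ k.val then t else 1) * b.coord k (graphFam b M i) := by
  induction k using Fin.addCases with
  | left k => rw [coord_castAdd_graphFam, coord_castAdd_graphFam]; simp [k.2.not_ge]
  | right k => rw [coord_natAdd_graphFam, coord_natAdd_graphFam]; simp

theorem plCoord_graphFam_smul (b : Basis (Fin (d + m)) ℂ V) (M : Matrix (Fin m) (Fin d) ℂ)
    (t : ℂ) (f : Fin d → Fin (d + m)) :
    plCoord b f (exteriorPower.ιMulti ℂ d (graphFam b (t • M))) =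
      t ^ highCount f * plCoord b f (exteriorPower.ιMulti ℂ d (graphFam b M)) := by
  have h1 : coordMatrix b f (graphFam b (t • M)) = Matrix.of fun i j =>
      (if d ≤ (f j).val then t else 1) * coordMatrix b f (graphFam b M) i j := by
    ext i j
    exact coord_graphFam_smul b M t i (f j)
  rw [plCoord_ιMulti, plCoord_ιMulti, h1, Matrix.det_mul_row, highCount]
  simp [Finset.prod_ite]

/-- If the degrees differ, pigeonhole gives a zero row or column in the determinant. -/
theorem highCount_eq_deg_of_plCoord_ne_zero (b : Basis (Fin (d + m)) ℂ V)
    {f : Fin d → Fin (d + m)} {I : Set.powersetCard (Fin (d + m)) d}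
    (h : plCoord b f (b.exteriorPower d I) ≠ 0) : highCount f = deg I := by
  have hf : Function.Injective f := by
    by_contra hf
    rw [plCoord_eq_zero_of_not_injective b hf] at h
    exact h rfl
  have hb : b.exteriorPower d I =
      exteriorPower.ιMulti ℂ d (b ∘ Set.powersetCard.ofFinEmbEquiv.symm I) := by
    rw [exteriorPower.basis_apply]; rfl
  rw [hb] at h
  rw [deg_eq_highCount]
  refine le_antisymm (not_lt.1 fun hlt => ?_) (not_lt.1 fun hlt => ?_)
  · obtain ⟨i, hi⟩ := exists_notMem_range_of_highCount_lt hf hlt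
    refine h ?_
    rw [plCoord_ιMulti]
    refine Matrix.det_eq_zero_of_column_eq_zero i fun j => ?_
    have : f i ≠ Set.powersetCard.ofFinEmbEquiv.symm I j := fun h => hi ⟨j, h.symm⟩
    simp [coordMatrix, Finsupp.single_eq_of_ne this]
  · obtain ⟨i, hi⟩ := exists_notMem_range_of_highCount_lt
      (Set.powersetCard.ofFinEmbEquiv.symm I).injective hlt
    exact h (pairing_eq_zero b _ _ i hi)

/-- The truncation map with the part of degree `k` multiplied by `u ^ (s - k)`. -/
def scaledTrunc (b : Basis (Fin (d + m)) ℂ V) (s : ℕ) (u : ℂ) :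
    (⋀[ℂ]^d V) →ₗ[ℂ] TruncWedge b s :=
  -- For degree above `s` the natural subtraction gives exponent `0`, but there `truncMap` vanishes.
  -- At `u = 0` exactly the part of degree `s` remains.
  (b.exteriorPower d).constr ℂ fun I => u ^ (s - deg I) • truncMap b s (b.exteriorPower d I)

theorem truncCoord_scaledTrunc (b : Basis (Fin (d + m)) ℂ V) {s : ℕ} (u : ℂ)
    {f : Fin d → Fin (d + m)} (hf : highCount f ≤ s) (w : ⋀[ℂ]^d V) :
    truncCoord b s f (scaledTrunc b s u w) = u ^ (s - highCount f) * plCoord b f w := by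
  have : (truncCoord b s f).comp (scaledTrunc b s u) = u ^ (s - highCount f) • plCoord b f := by
    refine (b.exteriorPower d).ext fun I => ?_
    rw [LinearMap.comp_apply, scaledTrunc, Basis.constr_basis, map_smul,
      truncCoord_truncMap b hf, LinearMap.smul_apply]
    by_cases h : plCoord b f (b.exteriorPower d I) = 0
    · rw [h, smul_zero, smul_zero]
    · rw [highCount_eq_deg_of_plCoord_ne_zero b h]
  exact LinearMap.congr_fun this w

/-- For `u ≠ 0` the scaled vector stays in the cone over the orbit, so `u → 0` is a degeneration
inside the closure. -/
theorem scaledTrunc_graphFam (b : Basis (Fin (d + m)) ℂ V) (s : ℕ) {u : ℂ} (hu : u ≠ 0)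
    (M : Matrix (Fin m) (Fin d) ℂ) :
    scaledTrunc b s u (exteriorPower.ιMulti ℂ d (graphFam b M)) =
      u ^ s • truncMap b s (exteriorPower.ιMulti ℂ d (graphFam b (u⁻¹ • M))) := by
  refine trunc_ext b fun f _ hf => ?_
  rw [truncCoord_scaledTrunc b u hf, map_smul, truncCoord_truncMap b hf, plCoord_graphFam_smul,
    smul_eq_mul, ← mul_assoc]
  congr 1
  rw [inv_pow, ← div_eq_mul_inv, eq_div_iff (pow_ne_zero _ hu), ← pow_add, Nat.sub_add_cancel hf]

theorem exists_polynomial_scaledTrunc (b : Basis (Fin (d + m)) ℂ V) (s : ℕ)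
    (l : Module.Dual ℂ (TruncWedge b s)) (w : ⋀[ℂ]^d V) :
    ∃ p : Polynomial ℂ, ∀ u : ℂ, l (scaledTrunc b s u w) = p.eval u := by
  refine ⟨∑ I, Polynomial.C ((b.exteriorPower d).repr w I *
    l (truncMap b s (b.exteriorPower d I))) * Polynomial.X ^ (s - deg I), fun u => ?_⟩
  rw [scaledTrunc, Basis.constr_apply_fintype, map_sum, Polynomial.eval_finsetSum]
  refine Finset.sum_congr rfl fun I _ => ?_
  simp only [map_smul, smul_eq_mul, Basis.equivFun_apply, Polynomial.eval_mul, Polynomial.eval_C,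
    Polynomial.eval_pow, Polynomial.eval_X]
  ring

/-- A form vanishing on the orbit vanishes on the top degree parts of the orbit. -/
theorem form_scaledTrunc_zero_eq_zero (b : Basis (Fin (d + m)) ℂ V) (s : ℕ) {k : ℕ}
    {g : TruncWedge b s → ℂ} (hg : IsForm k g)
    (h : ∀ M, g (truncMap b s (exteriorPower.ιMulti ℂ d (graphFam b M))) = 0)
    (M : Matrix (Fin m) (Fin d) ℂ) :
    g (scaledTrunc b s 0 (exteriorPower.ιMulti ℂ d (graphFam b M))) = 0 := by
  obtain ⟨p, hp⟩ := hg.exists_polynomial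
    (w := fun u => scaledTrunc b s u (exteriorPower.ιMulti ℂ d (graphFam b M))) fun l =>
      exists_polynomial_scaledTrunc b s l _
  -- The polynomial `p` vanishes for all `u ≠ 0`, hence identically; this replaces a limit argument.
  have h1 : p * Polynomial.X = 0 := by
    refine Polynomial.funext fun u => ?_
    rw [Polynomial.eval_mul, Polynomial.eval_zero, Polynomial.eval_X, ← hp]
    by_cases hu : u = 0
    · rw [hu, mul_zero]
    · rw [scaledTrunc_graphFam b s hu, hg.smul, h, mul_zero, zero_mul]
  rw [hp, (mul_eq_zero.1 h1).resolve_right Polynomial.X_ne_zero, Polynomial.eval_zero]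

theorem highCount_swapIndex {s : ℕ} (x : MinorIndex d m s) : highCount (swapIndex x) = s := by
  have : (Finset.univ.filter fun i => d ≤ (swapIndex x i).val) = x.1.1 := by
    ext k
    rw [Finset.mem_filter]
    by_cases h : k ∈ x.1.1
    · rw [swapIndex, dif_pos h]; simp [h]
    · rw [swapIndex, dif_neg h]; simp [h]
  rw [highCount, this]
  exact x.1.2

theorem swapIndex_eq_of_range_subset {s : ℕ} {x y : MinorIndex d m s}
    (hsub : Set.range (swapIndex y) ⊆ Set.range (swapIndex x)) : y = x := by
  refine Prod.ext (Subtype.ext ?_) (Subtype.ext ?_)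
  · symm
    refine Finset.eq_of_subset_of_card_le (fun k hk => ?_) (by rw [x.1.2, y.1.2])
    by_contra hk'
    exact (castAdd_mem_range_swapIndex x k).1
      (hsub ((castAdd_mem_range_swapIndex y k).2 hk')) hk
  · refine Finset.eq_of_subset_of_card_le (fun l hl => ?_) (by rw [x.2.2, y.2.2])
    exact (natAdd_mem_range_swapIndex x l).1 (hsub ((natAdd_mem_range_swapIndex y l).2 hl))

theorem plCoord_swapIndex (b : Basis (Fin (d + m)) ℂ V) {s : ℕ} (x y : MinorIndex d m s) :
    plCoord b (swapIndex x) (exteriorPower.ιMulti ℂ d (b ∘ swapIndex y)) =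
      if y = x then 1 else 0 := by
  split_ifs with h
  · subst h
    exact pairing_self b _ (swapIndex_injective y)
  · have h3 : ∃ i, swapIndex y i ∉ Set.range (swapIndex x) := by
      by_contra! hcon
      refine h (swapIndex_eq_of_range_subset ?_)
      rintro _ ⟨i, rfl⟩
      exact hcon i
    obtain ⟨i, hi⟩ := h3
    exact pairing_eq_zero b _ _ i hi

theorem plCoord_swapIndex_eq_zero (b : Basis (Fin (d + m)) ℂ V) {s : ℕ} (x : MinorIndex d m s)
    {f : Fin d → Fin (d + m)} (hf : highCount f < s) :
    plCoord b f (exteriorPower.ιMulti ℂ d (b ∘ swapIndex x)) = 0 := by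
  obtain ⟨i, hi⟩ := exists_notMem_range_of_highCount_lt (swapIndex_injective x)
    (by rwa [highCount_swapIndex] : highCount f < highCount (swapIndex x))
  exact pairing_eq_zero b _ _ i hi

/-- An injective index family of degree `s` is a rearrangement of some `swapIndex`. -/
theorem exists_range_eq_swapIndex {s : ℕ} {f : Fin d → Fin (d + m)} (hf : Function.Injective f)
    (hs : highCount f = s) : ∃ x : MinorIndex d m s, Set.range f = Set.range (swapIndex x) := by
  classical
  let S : Finset (Fin (d + m)) := Finset.univ.image f
  have hS : S.card = d := by
    rw [Finset.card_image_of_injective _ hf, Finset.card_univ, Fintype.card_fin]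
  -- `L` records the high indices that occur and `J` the low indices that are missing; both have `s`
  -- elements because `f` takes `d` values.
  let L : Finset (Fin m) := Finset.univ.filter fun l => Fin.natAdd d l ∈ S
  let J : Finset (Fin d) := Finset.univ.filter fun k => Fin.castAdd m k ∉ S
  have hL : L.card = s := by
    rw [← hs, highCount, ← Finset.card_image_of_injective L (Fin.natAdd_injective m d),
      ← Finset.card_image_of_injective (Finset.univ.filter fun i => d ≤ (f i).val) hf]
    congr 1
    ext k
    induction k using Fin.addCases with
    | left k =>
      simp only [Finset.mem_image, Finset.mem_filter, Finset.mem_univ, true_and]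
      constructor
      · rintro ⟨l, -, hl⟩
        exact absurd hl (natAdd_ne_castAdd _ _)
      · rintro ⟨i, hi, hik⟩
        rw [hik] at hi
        simp at hi
        omega
    | right k =>
      simp only [Finset.mem_image, Finset.mem_filter, Finset.mem_univ, true_and, L, S]
      constructor
      · rintro ⟨l, ⟨i, hi⟩, hl⟩
        refine ⟨i, ?_, hi.trans hl⟩
        rw [hi]; simp
      · rintro ⟨i, -, hik⟩
        exact ⟨k, ⟨i, hik⟩, rfl⟩
  have hJ : J.card = s := by
    have h1 : (Finset.univ.filter fun k : Fin d => Fin.castAdd m k ∈ S).card + L.card = d := by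
      rw [← Finset.card_image_of_injective L (Fin.natAdd_injective m d),
        ← Finset.card_image_of_injective (Finset.univ.filter fun k : Fin d => Fin.castAdd m k ∈ S)
          (Fin.castAdd_injective d m), ← Finset.card_union_of_disjoint]
      · refine Eq.trans (congrArg Finset.card ?_) hS
        ext k
        induction k using Fin.addCases with
        | left k => simp [L, natAdd_ne_castAdd]
        | right k => simp [L, (natAdd_ne_castAdd _ _).symm]
      · rw [Finset.disjoint_left]
        intro k hk hk'
        obtain ⟨i, -, rfl⟩ := Finset.mem_image.1 hk
        obtain ⟨j, -, hj⟩ := Finset.mem_image.1 hk'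
        exact natAdd_ne_castAdd _ _ hj
    have h2 := Finset.card_filter_add_card_filter_not (s := (Finset.univ : Finset (Fin d)))
      fun k => Fin.castAdd m k ∈ S
    rw [Finset.card_univ, Fintype.card_fin] at h2
    change (Finset.univ.filter fun k => Fin.castAdd m k ∉ S).card = s
    omega
  refine ⟨(⟨J, hJ⟩, ⟨L, hL⟩), ?_⟩
  have hSf : ∀ k, k ∈ Set.range f ↔ k ∈ S := fun k => by simp [S]
  ext k
  rw [hSf]
  induction k using Fin.addCases with
  | left k => rw [castAdd_mem_range_swapIndex]; simp [J]
  | right k => rw [natAdd_mem_range_swapIndex]; simp [L]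

/-- The two families differ by a permutation, whose sign is the scalar. -/
theorem exists_plCoord_eq_smul (b : Basis (Fin (d + m)) ℂ V) {f g : Fin d → Fin (d + m)}
    (hf : Function.Injective f) (h : Set.range f = Set.range g) :
    ∃ c : ℂ, plCoord b f = c • plCoord b g := by
  have h1 : ∀ i, ∃ j, g j = f i := fun i => by
    have : f i ∈ Set.range g := h ▸ ⟨i, rfl⟩
    exact this
  choose σ hσ using h1
  have hσi : Function.Injective σ := fun i j hij => hf (by rw [← hσ, ← hσ, hij])
  let e : Equiv.Perm (Fin d) := Equiv.ofBijective σ (Finite.injective_iff_bijective.1 hσi)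
  have h2 : b.coord ∘ f = fun i => (b.coord ∘ g) (e i) := by
    funext i
    simp [e, hσ]
  refine ⟨((Equiv.Perm.sign e : ℤˣ) : ℤ), ?_⟩
  rw [plCoord, plCoord, h2]
  have := (exteriorPower.ιMulti ℂ d).map_perm (b.coord ∘ g) e
  rw [show (fun i => (b.coord ∘ g) (e i)) = (b.coord ∘ g) ∘ e from rfl, this]
  rcases Int.units_eq_one_or (Equiv.Perm.sign e) with h3 | h3 <;> simp [h3]

/-- An element of `(Λ^d V)_s` without components of degree less than `s` is a combination of
the vectors `v_I` of degree `s`. -/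
theorem eq_sum_swapIndex (b : Basis (Fin (d + m)) ℂ V) {s : ℕ} {q : TruncWedge b s}
    (hq : ∀ f : Fin d → Fin (d + m), highCount f < s → truncCoord b s f q = 0) :
    q = ∑ x : MinorIndex d m s, truncCoord b s (swapIndex x) q •
      truncMap b s (exteriorPower.ιMulti ℂ d (b ∘ swapIndex x)) := by
  classical
  refine trunc_ext b fun f hf hfs => ?_
  simp only [map_sum, map_smul, truncCoord_truncMap b hfs, smul_eq_mul]
  rcases hfs.lt_or_eq with hlt | heq
  · rw [hq f hlt]
    symm
    refine Finset.sum_eq_zero fun x _ => ?_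
    rw [plCoord_swapIndex_eq_zero b x hlt, mul_zero]
  · obtain ⟨x, hx⟩ := exists_range_eq_swapIndex hf heq
    obtain ⟨c, hc⟩ := exists_plCoord_eq_smul b hf hx
    have h1 : truncCoord b s f q = c * truncCoord b s (swapIndex x) q := by
      rw [truncCoord, truncCoord, hc]; rfl
    rw [h1, hc]
    simp only [LinearMap.smul_apply, plCoord_swapIndex, smul_eq_mul, mul_ite, mul_one, mul_zero,
      Finset.sum_ite_eq', Finset.mem_univ, if_true]
    ring

theorem homIncl_apply (b : Basis (Fin (d + m)) ℂ V) (s : ℕ) (ψ : WedgeHom b s) :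
    homIncl b s ψ = ∑ x : MinorIndex d m s, homCoord b s x ψ •
      truncMap b s (exteriorPower.ιMulti ℂ d (b ∘ swapIndex x)) := by
  simp [homIncl]

theorem truncCoord_homIncl (b : Basis (Fin (d + m)) ℂ V) {s : ℕ} (ψ : WedgeHom b s)
    {f : Fin d → Fin (d + m)} (hf : highCount f < s) :
    truncCoord b s f (homIncl b s ψ) = 0 := by
  rw [homIncl_apply, map_sum]
  refine Finset.sum_eq_zero fun x _ => ?_
  rw [map_smul, truncCoord_truncMap b hf.le, plCoord_swapIndex_eq_zero b x hf, smul_zero]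

theorem exists_homCoord_eq (b : Basis (Fin (d + m)) ℂ V) (s : ℕ) (a : MinorIndex d m s → ℂ) :
    ∃ ψ : WedgeHom b s, ∀ x, homCoord b s x ψ = a x := by
  classical
  refine ⟨((lowBasis b).exteriorPower s).constr ℂ fun J =>
    ∑ L, a (J, L) • (highBasis b).exteriorPower s L, fun x => ?_⟩
  simp only [homCoord, LinearMap.comp_apply, LinearMap.applyₗ_apply_apply, Basis.constr_basis,
    map_sum, map_smul, Basis.coord_apply, Basis.repr_self, smul_eq_mul, Finsupp.single_apply,
    mul_ite, mul_one, mul_zero, Finset.sum_ite_eq', Finset.mem_univ, if_true]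

theorem isForm_eval_homCoord (b : Basis (Fin (d + m)) ℂ V) (s : ℕ) {k : ℕ}
    {F : MvPolynomial (MinorIndex d m s) ℂ} (hF : F.IsHomogeneous k) :
    IsForm k fun ψ : WedgeHom b s => MvPolynomial.eval (fun x => homCoord b s x ψ) F :=
  IsForm.eval (W := WedgeHom b s) hF _

/-- The minors of a matrix are the Plücker coordinates of its graph. -/
theorem plCoord_swapIndex_graphFam (b : Basis (Fin (d + m)) ℂ V) {s : ℕ} (x : MinorIndex d m s)
    (M : Matrix (Fin m) (Fin d) ℂ) :
    plCoord b (swapIndex x) (exteriorPower.ιMulti ℂ d (graphFam b M)) =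
      MvPolynomial.eval (fun ij => M ij.1 ij.2) (minor d m s x) := by
  classical
  rw [plCoord_ιMulti]
  set A := coordMatrix b (swapIndex x) (graphFam b M) with hA
  obtain ⟨P, hP⟩ : ∃ P : Fin d → Prop, ∀ k, P k ↔ k ∈ x.1.1 := ⟨_, fun _ => Iff.rfl⟩
  have h0 : ∀ i j, j ∉ x.1.1 → A i j = if i = j then 1 else 0 := by
    intro i j hj
    rw [hA, coordMatrix, Matrix.of_apply, swapIndex, dif_neg hj, coord_castAdd_graphFam]
  -- The columns outside `J` are unit vectors, so the determinant reduces to the block on `J`. That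
  -- block is the transposed minor, with no sign since `swapIndex` matches `J` and `L` increasingly.
  rw [Matrix.twoBlockTriangular_det' A P fun i hi j hj => by
    rw [h0 i j (fun h => hj ((hP j).2 h)), if_neg]
    rintro rfl
    exact hj hi]
  have h1 : A.toSquareBlockProp (fun k => ¬ P k) = 1 := by
    ext i j
    rw [Matrix.toSquareBlockProp_def, Matrix.of_apply, h0 _ _ (fun h => j.2 ((hP _).2 h)),
      Matrix.one_apply]
    simp [Subtype.ext_iff]
  rw [h1, Matrix.det_one, mul_one, minor, RingHom.map_det, ← Matrix.det_transpose]
  let e := x.1.1.orderIsoOfFin (Set.powersetCard.card_eq x.1)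
  let e' : Fin s ≃ {k // P k} :=
    e.toEquiv.trans (Equiv.subtypeEquivRight fun k => (hP k).symm)
  rw [← Matrix.det_submatrix_equiv_self e']
  congr 1
  ext i j
  have h2 : A (e j).1 (e i).1 = M (Set.powersetCard.ofFinEmbEquiv.symm x.2 i)
      (Set.powersetCard.ofFinEmbEquiv.symm x.1 j) := by
    rw [hA, coordMatrix, Matrix.of_apply, swapIndex, dif_pos (e i).2, coord_natAdd_graphFam]
    congr 2
    exact e.symm_apply_apply i
  simp only [RingHom.mapMatrix_apply, Matrix.map_apply, Matrix.of_apply, MvPolynomial.eval_X]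
  exact h2

theorem homCoord_map (b : Basis (Fin (d + m)) ℂ V) {s : ℕ} (x : MinorIndex d m s)
    (M : Matrix (Fin m) (Fin d) ℂ) :
    homCoord b s x (exteriorPower.map s (Matrix.toLin (lowBasis b) (highBasis b) M)) =
      MvPolynomial.eval (fun ij => M ij.1 ij.2) (minor d m s x) := by
  rw [homCoord, LinearMap.comp_apply, LinearMap.applyₗ_apply_apply, exteriorPower.basis_apply,
    exteriorPower.basis_coord, exteriorPower.map_apply_ιMulti_family, exteriorPower.ιMulti_family,
    exteriorPower.ιMultiDual_apply_ιMulti, minor, RingHom.map_det, ← Matrix.det_transpose]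
  congr 1
  ext i j
  simp [Matrix.toLin_self, Finsupp.single_apply]

/-- The top degree part of the orbit consists of the exterior powers of linear maps. -/
theorem scaledTrunc_zero_graphFam (b : Basis (Fin (d + m)) ℂ V) (s : ℕ)
    (M : Matrix (Fin m) (Fin d) ℂ) :
    scaledTrunc b s 0 (exteriorPower.ιMulti ℂ d (graphFam b M)) =
      homIncl b s (exteriorPower.map s (Matrix.toLin (lowBasis b) (highBasis b) M)) := by
  rw [homIncl_apply]
  refine (eq_sum_swapIndex b fun f hf => ?_).trans (Finset.sum_congr rfl fun x _ => ?_)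
  · rw [truncCoord_scaledTrunc b 0 hf.le, zero_pow (Nat.sub_ne_zero_of_lt hf), zero_mul]
  rw [truncCoord_scaledTrunc b 0 (highCount_swapIndex x).le, highCount_swapIndex, Nat.sub_self,
    pow_zero, one_mul, plCoord_swapIndex_graphFam, homCoord_map]

/-- The points of the truncated Grassmannian without coordinates of degree less than `s` are
the points of `Proj(R_{s;d,m})`. -/
theorem mem_image_minorVariety_iff (b : Basis (Fin (d + m)) ℂ V) {s : ℕ} (hs : s ≠ 0)
    (p : ℙ ℂ (TruncWedge b s)) :
    p ∈ homEmb b s '' minorVariety b hs ↔ p ∈ truncGr b s ∧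
      ∀ f : Fin d → Fin (d + m), highCount f < s → truncCoord b s f p.rep = 0 := by
  constructor
  · rintro ⟨p, hp, rfl⟩
    have hne : homIncl b s p.rep ≠ 0 := fun h =>
      p.rep_nonzero (homIncl_injective b s (h.trans (map_zero _).symm))
    have hmk : homEmb b s p = Projectivization.mk ℂ _ hne := by
      conv_lhs => rw [← p.mk_rep]
      rfl
    rw [hmk]
    constructor
    · rw [mem_truncGr_iff]
      intro k g hg h
      rw [hg.eq_zero_iff_rep]
      -- On the degree `s` part the form `g` becomes a polynomial `F` in the coefficients, and the
      -- degeneration shows that `F` is a relation between the minors.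
      obtain ⟨F, hF, hF'⟩ := hg.exists_mvPolynomial fun x : MinorIndex d m s =>
        truncMap b s (exteriorPower.ιMulti ℂ d (b ∘ swapIndex x))
      rw [homIncl_apply, hF']
      refine (mem_minorVariety_iff b hs p).1 hp k F hF fun z => ?_
      have h1 := form_scaledTrunc_zero_eq_zero b s hg h (Matrix.of fun i j => z (i, j))
      rw [scaledTrunc_zero_graphFam, homIncl_apply, hF'] at h1
      simp only [homCoord_map] at h1
      exact h1
    · intro f hf
      rw [(IsForm.dual (truncCoord b s f)).eq_zero_iff_rep]
      exact truncCoord_homIncl b _ hf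
  · rintro ⟨hp, h0⟩
    obtain ⟨ψ, hψ⟩ := exists_homCoord_eq b s fun x => truncCoord b s (swapIndex x) p.rep
    have h1 : homIncl b s ψ = p.rep := by
      rw [homIncl_apply]
      simp only [hψ]
      exact (eq_sum_swapIndex b h0).symm
    have hψ0 : ψ ≠ 0 := by
      rintro rfl
      rw [map_zero] at h1
      exact p.rep_nonzero h1.symm
    refine ⟨Projectivization.mk ℂ ψ hψ0, ?_, ?_⟩
    · rw [mem_minorVariety_iff]
      intro k F hF h
      refine ((isForm_eval_homCoord b s hF).eq_zero_iff_rep hψ0).2 ?_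
      simp only [hψ]
      -- Conversely, a relation evaluated at the degree `s` coordinates is a form on `(Λ^d V)_s`
      -- that vanishes on the orbit.
      refine (mem_truncGr_iff b s p).1 hp k _
        (IsForm.eval hF fun x => truncCoord b s (swapIndex x)) fun M => ?_
      simp only [truncCoord_truncMap b (highCount_swapIndex _).le, plCoord_swapIndex_graphFam]
      exact h fun ij => M ij.1 ij.2
    · conv_rhs => rw [← p.mk_rep]
      rw [homEmb, Projectivization.map_mk]
      congr 1

/-- Some exterior power `Λ^s φ` is nonzero. -/
theorem exists_map_ne_zero (b : Basis (Fin (d + m)) ℂ V) {s : ℕ} (hsd : s ≤ d) (hsm : s ≤ m) :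
    ∃ φ : lowSpace b →ₗ[ℂ] highSpace b, exteriorPower.map s φ ≠ 0 := by
  classical
  obtain ⟨J, hJ⟩ := Finset.exists_subset_card_eq (s := (Finset.univ : Finset (Fin d)))
    (n := s) (by simpa using hsd)
  obtain ⟨L, hL⟩ := Finset.exists_subset_card_eq (s := (Finset.univ : Finset (Fin m)))
    (n := s) (by simpa using hsm)
  let x : MinorIndex d m s := (⟨J, hJ.2⟩, ⟨L, hL.2⟩)
  -- A partial permutation matrix matching `J` with `L` increasingly; its minor on `(J, L)` is the
  -- determinant of the identity.
  let M : Matrix (Fin m) (Fin d) ℂ := Matrix.of fun i j =>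
    if ∃ t, Set.powersetCard.ofFinEmbEquiv.symm x.2 t = i ∧
      Set.powersetCard.ofFinEmbEquiv.symm x.1 t = j then 1 else 0
  refine ⟨Matrix.toLin (lowBasis b) (highBasis b) M, fun h => ?_⟩
  have h1 := homCoord_map b x M
  rw [h, map_zero, minor, RingHom.map_det] at h1
  have h2 : (MvPolynomial.eval fun ij : Fin m × Fin d => M ij.1 ij.2).mapMatrix
      (Matrix.of fun i j : Fin s => MvPolynomial.X (Set.powersetCard.ofFinEmbEquiv.symm x.2 i,
      Set.powersetCard.ofFinEmbEquiv.symm x.1 j)) = 1 := by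
    ext i j
    simp [M, Matrix.one_apply, EmbeddingLike.apply_eq_iff_eq]
  rw [h2, Matrix.det_one] at h1
  exact zero_ne_one h1

theorem minorVariety_eq_closure (b : Basis (Fin (d + m)) ℂ V) {s : ℕ} (hs : s ≠ 0) (hsd : s ≤ d)
    (hsm : s ≤ m) :
    minorVariety b hs = closure[zariski (WedgeHom b s)] (wedgeLocus b s) := by
  classical
  ext p
  rw [mem_minorVariety_iff, mem_closure_zariski_iff]
  constructor
  · intro h k g hg h0
    choose e he using fun x : MinorIndex d m s => exists_homCoord_eq b s (Pi.single x 1)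
    have hsum : ∀ ψ : WedgeHom b s, ψ = ∑ x, homCoord b s x ψ • e x := fun ψ =>
      homCoord_ext b fun y => by simp [he, Pi.single_apply]
    obtain ⟨F, hF, hF'⟩ := hg.exists_mvPolynomial e
    have h1 : ∀ φ : lowSpace b →ₗ[ℂ] highSpace b, g (exteriorPower.map s φ) = 0 := by
      have h2 : ∀ φ : lowSpace b →ₗ[ℂ] highSpace b, exteriorPower.map s φ ≠ 0 →
          g (exteriorPower.map s φ) = 0 := fun φ hφ =>
        (hg.eq_zero_iff_rep hφ).1 (h0 _ ⟨φ, hφ, rfl⟩)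
      intro φ
      -- Maps with `Λ^s φ = 0` give no point of the locus, so `g 0 = 0` needs an argument. For
      -- degree zero it relies on the locus being nonempty, which is where `s ≤ d` and `s ≤ m`
      -- enter.
      by_cases hφ : exteriorPower.map s φ = 0
      · obtain ⟨φ', hφ'⟩ := exists_map_ne_zero b hsd hsm
        have h3 := hg.smul 0 (exteriorPower.map s φ')
        rw [h2 φ' hφ', mul_zero, zero_smul] at h3
        rw [hφ, h3]
      · exact h2 φ hφ
    rw [hsum p.rep, hF']
    refine h k F hF fun z => ?_
    have h4 := h1 (Matrix.toLin (lowBasis b) (highBasis b) (Matrix.of fun i j => z (i, j)))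
    rw [hsum (exteriorPower.map s _), hF'] at h4
    simp only [homCoord_map] at h4
    exact h4
  · intro h k F hF h0
    refine h k _ (isForm_eval_homCoord b s hF) ?_
    rintro _ ⟨φ, hφ, rfl⟩
    refine ((isForm_eval_homCoord b s hF).eq_zero_iff_rep hφ).2 ?_
    rw [← Matrix.toLin_toMatrix (lowBasis b) (highBasis b) φ]
    simp only [homCoord_map]
    exact h0 fun ij => LinearMap.toMatrix (lowBasis b) (highBasis b) φ ij.1 ij.2

end Boundary

end TruncGr

end

theorem mainTheorem9 {V : Type*} [AddCommGroup V] [Module ℂ V] (d m r : ℕ)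
    (hd : 1 ≤ d) (hdm : d ≤ m) (hr : 2 ≤ r) (hrd : r ≤ d + 1)
    (b : Module.Basis (Fin (d + m)) ℂ V) :
    -- the projection is defined on `Gr_d(V) ∖ S_{r-1}`, an open subset of the Grassmannian,
    Function.Injective (TruncGr.plucker b) ∧
    TruncGr.IsOpenIn (TruncGr.openPart b (r - 1)) (Set.range (TruncGr.plucker b)) ∧
    (∃ hdom : TruncGr.openPart b (r - 1) ⊆ TruncGr.projDomain (TruncGr.truncMap b (r - 1)),
      -- and embeds it as an open subset of `X_{r-1}`
      TruncGr.IsRegularEmbedding (TruncGr.truncProj b (r - 1) hdom) ∧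
      TruncGr.IsOpenIn (Set.range (TruncGr.truncProj b (r - 1) hdom))
        (TruncGr.truncGr b (r - 1)) ∧
      -- whose complement is the image of `Proj(R_{r-1;d,n-d})`
      TruncGr.truncGr b (r - 1) = Set.range (TruncGr.truncProj b (r - 1) hdom) ∪
        TruncGr.homEmb b (r - 1) '' TruncGr.minorVariety b (Nat.sub_ne_zero_of_lt hr) ∧
      Disjoint (Set.range (TruncGr.truncProj b (r - 1) hdom))
        (TruncGr.homEmb b (r - 1) '' TruncGr.minorVariety b (Nat.sub_ne_zero_of_lt hr))) ∧
    -- `Proj(R_{r-1;d,n-d})` is a closed subscheme of `ℙ Hom(Λ^{r-1} V_d, Λ^{r-1} V_{n-d})`, and as a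
    -- variety it is the closure of the set of all `[Λ^{r-1} φ]`
    AlgebraicGeometry.IsClosedImmersion
      (TruncGr.minorProjEmb d m (Nat.sub_ne_zero_of_lt hr)) ∧
    TruncGr.minorVariety b (Nat.sub_ne_zero_of_lt hr) =
      closure[TruncGr.zariski (TruncGr.WedgeHom b (r - 1))] (TruncGr.wedgeLocus b (r - 1)) := by
  have hs : r - 1 ≤ d := by omega
  have hdom := TruncGr.openPart_subset_projDomain b (r - 1)
  refine ⟨TruncGr.plucker_injective b, TruncGr.isOpenIn_openPart b (r - 1),
    ⟨hdom, TruncGr.isRegularEmbedding_truncProj b (r - 1) hdom,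
      TruncGr.isOpenIn_range_truncProj b hd (r - 1) hdom, ?_, ?_⟩,
    TruncGr.isClosedImmersion_minorProjEmb d m _,
    TruncGr.minorVariety_eq_closure b _ hs (hs.trans hdm)⟩
  -- Both pieces are cut out of `X_{r-1}` by complementary conditions: some coordinate of degree
  -- less than `r - 1` is nonzero, or all of them vanish.
  · ext p
    rw [Set.mem_union, TruncGr.mem_range_truncProj_iff_mem_truncGr b hd,
      TruncGr.mem_image_minorVariety_iff, ← and_or_left, iff_self_and]
    intro _
    by_contra! h
    obtain ⟨f, hf, hf'⟩ := h.2
    exact hf' (h.1 f hf)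
  · rw [Set.disjoint_left]
    intro p hp hp'
    obtain ⟨-, f, hf, hf'⟩ := (TruncGr.mem_range_truncProj_iff_mem_truncGr b hd _ hdom p).1 hp
    exact hf' (((TruncGr.mem_image_minorVariety_iff b _ p).1 hp').2 f hf)
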